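/- Let $H$ be a complex separable infinite-dimensional Hilbert space; "ideal" means two-sided ideal of the algebra $B(H)$ of bounded operators, and $K(H)$ is the ideal of compact operators. Let $c_o^*$ be the set of nonnegative real sequences that decrease (weakly) to $0$. The characteristic set of an ideal $I$ is $\Sigma(I)=\{\xi\in c_o^* : \xi=s(X)\text{ for some }X\in I\}$, where $s(X)$ is the sequence of $s$-numbers of $X$; by Calkin's correspondence an ideal contained in $K(H)$ is determined by its characteristic set. The soft interior of $I$ is the product ideal $\operatorname{se} I:=I\,K(H)$, and the soft cover $\operatorname{sc} I:=I:K(H)$ is the ideal with characteristic set $\{\xi\in c_o^* : \alpha\xi\in\Sigma(I)\text{ for all }\alpha\in c_o^*\}$. The ideal $I$ is soft-edged if $\operatorname{se} I=I$. Ideals $I\subset J$ form a soft pair if $\operatorname{se} J=I$ and $\operatorname{sc} I=J$. The ideal $I$ is strongly soft-complemented if for every sequence $\{\eta^{(k)}\}_{k\ge 1}\subset c_o^*\setminus\Sigma(I)$ there are indices $n_k$ such that $\xi\notin\Sigma(I)$ whenever $\xi\in c_o^*$ and $\xi_i\ge\eta^{(k)}_i$ for all $k$ and all $1\le i\le n_k$.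 A symmetric norming function is a norm $\phi$ on the space of finitely supported real sequences that is invariant under permutations and sign changes of the entries (whether or not normalized by $\phi(\langle 1,0,0,\ldots\rangle)=1$); it is extended to all real sequences by $\phi(\xi):=\sup_n\phi(\langle\xi_1,\ldots,\xi_n,0,0,\ldots\rangle)\in[0,\infty]$. Let $\mathfrak S_\phi$ (the maximal Banach ideal) and $\mathfrak S_\phi^{(o)}$ (the minimal Banach ideal) be the ideals with characteristic sets $$\Sigma(\mathfrak S_\phi)=\{\xi\in c_o^* : \phi(\xi)<\infty\},\qquad \Sigma(\mathfrak S_\phi^{(o)})=\{\xi\in\Sigma(\mathfrak S_\phi) : \phi(\langle\xi_n,\xi_{n+1},\ldots\rangle)\to 0\text{ as }n\to\infty\}.$$ **Proposition.** For every symmetric norming function $\phi$, the ideal $\mathfrak S_\phi^{(o)}$ is soft-edged, the ideal $\mathfrak S_\phi$ is strongly soft-complemented, and $\mathfrak S_\phi^{(o)}\subset\mathfrak S_\phi$ is a soft pair, that is, $\operatorname{se}\mathfrak S_\phi=\mathfrak S_\phi^{(o)}$ and $\operatorname{sc}\mathfrak S_\phi^{(o)}=\mathfrak S_\phi$. -/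

import Mathlib

/-- `c₀*`: the real sequences (indexed from `0`) that decrease (not necessarily strictly) to `0`;
such a sequence is automatically nonnegative. -/
def cZeroStar : Set (ℕ → ℝ) :=
  {ξ | Antitone ξ ∧ Filter.Tendsto ξ Filter.atTop (nhds 0)}

/-- A symmetric norming function: a norm on the space of finitely supported real sequences
whose value does not change when the entries are permuted or change sign.
No normalization `φ ⟨1, 0, 0, …⟩ = 1` is imposed; normalized functions are included. -/
structure SymmetricNormingFunction where
  /-- the underlying function -/
  toFun : (ℕ →₀ ℝ) → ℝ
  pos' : ∀ f : ℕ →₀ ℝ, f ≠ 0 → 0 < toFun f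
  smul' : ∀ (c : ℝ) (f : ℕ →₀ ℝ), toFun (c • f) = |c| * toFun f
  add_le' : ∀ f g : ℕ →₀ ℝ, toFun (f + g) ≤ toFun f + toFun g
  perm' : ∀ (σ : Equiv.Perm ℕ) (f : ℕ →₀ ℝ), toFun (f.equivMapDomain σ) = toFun f
  abs' : ∀ f g : ℕ →₀ ℝ, (∀ i, |f i| = |g i|) → toFun f = toFun g

/-- The finitely supported sequence `⟨ξ 0, …, ξ (n - 1), 0, 0, …⟩`. -/
noncomputable def truncSeq (ξ : ℕ → ℝ) (n : ℕ) : ℕ →₀ ℝ :=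
  ∑ i ∈ Finset.range n, Finsupp.single i (ξ i)

namespace SymmetricNormingFunction

/-- The extension `φ(ξ) = sup_n φ(⟨ξ_1, …, ξ_n, 0, 0, …⟩) ∈ [0, ∞]` to all real sequences. -/
noncomputable def ext (φ : SymmetricNormingFunction) (ξ : ℕ → ℝ) : ENNReal :=
  ⨆ n : ℕ, ENNReal.ofReal (φ.toFun (truncSeq ξ n))

/-- The characteristic set of the maximal ideal `𝔖_φ`. -/
def maxSet (φ : SymmetricNormingFunction) : Set (ℕ → ℝ) :=
  {ξ | ξ ∈ cZeroStar ∧ φ.ext ξ < ⊤}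

/-- The characteristic set of the minimal ideal `𝔖_φ^{(o)}`: the sequences in the
characteristic set of `𝔖_φ` with `φ(⟨ξ_n, ξ_{n+1}, …⟩) → 0`. -/
def minSet (φ : SymmetricNormingFunction) : Set (ℕ → ℝ) :=
  {ξ | ξ ∈ φ.maxSet ∧
    Filter.Tendsto (fun n : ℕ => φ.ext (fun i => ξ (n + i))) Filter.atTop (nhds 0)}

end SymmetricNormingFunction

section OperatorIdeals

variable {H : Type*} [NormedAddCommGroup H] [InnerProductSpace ℂ H]

/-- The sequence of `s`-numbers (singular numbers) of a bounded operator, indexed from `0`: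
`s_n(T)` is the distance from `T` to the operators of rank at most `n`. For compact `T` on a
Hilbert space these are the eigenvalues of `(T* T)^{1/2}` in decreasing order, repeated according
to multiplicity (and continued by zeros if `T` has finite rank). -/
noncomputable def sNumbers (T : H →L[ℂ] H) (n : ℕ) : ℝ :=
  sInf {r : ℝ | ∃ F : H →L[ℂ] H, LinearMap.rank (F : H →ₗ[ℂ] H) ≤ (n : Cardinal) ∧ r = ‖T - F‖}

/-- The characteristic set `Σ(I) ⊆ c₀*` of a two-sided ideal `I` of `B(H)`: the sequences in
`c₀*` that are the sequence of `s`-numbers of an operator in `I`. -/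
def charSet (I : TwoSidedIdeal (H →L[ℂ] H)) : Set (ℕ → ℝ) :=
  {ξ | ξ ∈ cZeroStar ∧ ∃ T ∈ I, sNumbers T = ξ}

/-- The ideal of `B(H)` associated with a set `S ⊆ c₀*`: the two-sided ideal generated by the
compact operators whose sequence of `s`-numbers lies in `S`. When `S` is a characteristic set, this
is the ideal with characteristic set `S` given by Calkin's correspondence. -/
def idealOfCharSet (H : Type*) [NormedAddCommGroup H] [InnerProductSpace ℂ H]
    (S : Set (ℕ → ℝ)) : TwoSidedIdeal (H →L[ℂ] H) :=
  TwoSidedIdeal.span {T : H →L[ℂ] H | IsCompactOperator T ∧ sNumbers T ∈ S}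

/-- The ideal `K(H)` of compact operators. -/
def compactIdeal (H : Type*) [NormedAddCommGroup H] [InnerProductSpace ℂ H] :
    TwoSidedIdeal (H →L[ℂ] H) :=
  TwoSidedIdeal.mk' {T : H →L[ℂ] H | IsCompactOperator T}
    (by rw [Set.mem_ofPred_eq]; exact isCompactOperator_zero)
    (by intro x y hx hy; rw [Set.mem_ofPred_eq] at *; exact IsCompactOperator.add hx hy)
    (by intro x hx; rw [Set.mem_ofPred_eq] at *; exact IsCompactOperator.neg hx)
    (by intro x y hy; rw [Set.mem_ofPred_eq] at *; exact IsCompactOperator.clm_comp hy x)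
    (by intro x y hx; rw [Set.mem_ofPred_eq] at *; exact IsCompactOperator.comp_clm hx y)

theorem mem_compactIdeal {T : H →L[ℂ] H} : T ∈ compactIdeal H ↔ IsCompactOperator T := by
  rw [compactIdeal, TwoSidedIdeal.mem_mk', Set.mem_ofPred_eq]

/-- The product `I J` of two ideals: the two-sided ideal generated by the products `X Y` with
`X ∈ I` and `Y ∈ J`. -/
def idealProduct (I J : TwoSidedIdeal (H →L[ℂ] H)) : TwoSidedIdeal (H →L[ℂ] H) :=
  TwoSidedIdeal.span {T : H →L[ℂ] H | ∃ X ∈ I, ∃ Y ∈ J, T = X * Y}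

/-- The soft interior `se I = I K(H)`. -/
def softInterior (I : TwoSidedIdeal (H →L[ℂ] H)) : TwoSidedIdeal (H →L[ℂ] H) :=
  idealProduct I (compactIdeal H)

/-- The soft cover `sc I = I : K(H)`: the ideal with characteristic set
`{ξ ∈ c₀* | α ξ ∈ Σ(I) for all α ∈ c₀*}`. -/
def softCover (I : TwoSidedIdeal (H →L[ℂ] H)) : TwoSidedIdeal (H →L[ℂ] H) :=
  idealOfCharSet H {ξ | ξ ∈ cZeroStar ∧ ∀ α ∈ cZeroStar, α * ξ ∈ charSet I}

/-- An ideal is soft-edged if `se I = I`. -/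
def IsSoftEdged (I : TwoSidedIdeal (H →L[ℂ] H)) : Prop :=
  softInterior I = I

/-- A pair of ideals `I ⊆ J` is a soft pair if `se J = I` and `sc I = J`. -/
def IsSoftPair (I J : TwoSidedIdeal (H →L[ℂ] H)) : Prop :=
  I ≤ J ∧ softInterior J = I ∧ softCover I = J

/-- An ideal is strongly soft-complemented if for every sequence `η^{(k)}` in `c₀* \ Σ(I)` there
are indices `n_k` such that `ξ ∉ Σ(I)` whenever `ξ ∈ c₀*` dominates the first `n_k` entries of
`η^{(k)}` for every `k`. -/
def IsStronglySoftComplemented (I : TwoSidedIdeal (H →L[ℂ] H)) : Prop :=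
  ∀ η : ℕ → ℕ → ℝ, (∀ k, η k ∈ cZeroStar \ charSet I) →
    ∃ n : ℕ → ℕ, ∀ ξ ∈ cZeroStar, (∀ k, ∀ i < n k, η k i ≤ ξ i) → ξ ∉ charSet I

/-- The maximal Banach ideal `𝔖_φ` of `B(H)`. -/
def maximalIdeal (H : Type*) [NormedAddCommGroup H] [InnerProductSpace ℂ H]
    (φ : SymmetricNormingFunction) : TwoSidedIdeal (H →L[ℂ] H) :=
  idealOfCharSet H φ.maxSet

/-- The minimal Banach ideal `𝔖_φ^{(o)}` of `B(H)`. -/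
def minimalIdeal (H : Type*) [NormedAddCommGroup H] [InnerProductSpace ℂ H]
    (φ : SymmetricNormingFunction) : TwoSidedIdeal (H →L[ℂ] H) :=
  idealOfCharSet H φ.minSet

end OperatorIdeals

/-! Both ideals are described through the quantity `opExt`, φ(s(T)). Since s_{2n}(S + T) ≤ s_n(S) +
s_n(T), it satisfies a triangle inequality with constant 2, which suffices. The maximal ideal
consists of the compact operators with φ(s(T)) finite (`mem_maximalIdeal`), the minimal one of the
limits of finite-rank operators in this quasi-norm (`mem_minimalIdeal`). Diagonal operators realize
every sequence of c₀*, so the two characteristic sets are the expected ones.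

The soft interior is squeezed between two inclusions. If φ(s(X)) is finite and Y is compact, then XY
is a quasi-norm limit of operators XG with G of finite rank, so se 𝔖_φ lies in the minimal ideal.
Conversely an approximable T factors as XY with X approximable and Y compact (`exists_eq_mul`): Y
damps successive blocks of the domain by 2⁻ᵐ, and X undoes this, which is affordable because T is
quasi-norm small on late blocks.

The other claims concern sequences. If φ(ξ) is infinite, a slowly decaying α keeps φ(αξ) infinite,
while αξ has vanishing tails if φ(ξ) is finite; this gives the soft cover. Infinite norm is detected
on finite segments: one segment of norm above k for each k gives strong soft-complementedness. -/

namespace SymmetricNormingFunction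

/-! ### Monotonicity and rearrangement invariance of symmetric norms -/

variable (φ : SymmetricNormingFunction)

lemma toFun_nonneg (f : ℕ →₀ ℝ) : 0 ≤ φ.toFun f := by
  by_cases h : f = 0
  · subst h
    have := φ.smul' 0 0
    simp at this
    exact this.ge
  · exact (φ.pos' f h).le

/-- Coordinates are enlarged one at a time: f is a convex combination of the two sequences obtained
by replacing f a by ± g a, and these have equal norm by sign invariance. -/
lemma toFun_mono_aux (s : Finset ℕ) : ∀ f g : ℕ →₀ ℝ, (∀ i, |f i| ≤ |g i|) →
    (∀ i ∉ s, f i = g i) → φ.toFun f ≤ φ.toFun g := by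
  classical
  induction s using Finset.induction_on with
  | empty =>
    intro f g _ h
    rw [Finsupp.ext fun i => h i (by simp)]
  | insert a s ha ih =>
    intro f g hle h
    obtain ⟨t, ht, hft⟩ : ∃ t : ℝ, |t| ≤ 1 ∧ f a = t * g a := by
      by_cases hg : g a = 0
      · refine ⟨0, by simp, ?_⟩
        have := hle a
        rw [hg, abs_zero] at this
        simpa [hg] using this
      · refine ⟨f a / g a, ?_, by field_simp⟩
        rw [abs_div]
        exact div_le_one_of_le₀ (hle a) (abs_nonneg _)
    have ht' := abs_le.mp ht
    -- `f'` agrees with `g` at `a` and with `f` elsewhere; `f''` has the opposite value at `a`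
    set f' := f.update a (g a) with hf'
    set f'' := f.update a (-g a) with hf''
    have e1 : φ.toFun f'' = φ.toFun f' := by
      apply φ.abs'
      intro i
      by_cases hi : i = a <;> simp [hf', hf'', Finsupp.update_apply, hi]
    have e2 : φ.toFun f' ≤ φ.toFun g := by
      apply ih
      · intro i
        by_cases hi : i = a
        · simp [hf', Finsupp.update_apply, hi]
        · simpa [hf', Finsupp.update_apply, hi] using hle i
      · intro i hi
        by_cases hia : i = a
        · simp [hf', Finsupp.update_apply, hia]
        · simpa [hf', Finsupp.update_apply, hia] using h i (by simp [hi, hia])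
    have e3 : f = ((1 + t) / 2) • f' + ((1 - t) / 2) • f'' := by
      ext i
      by_cases hi : i = a
      · subst hi
        simp [hf', hf'', hft]
        ring
      · simp [hf', hf'', hi]
        ring
    calc φ.toFun f = φ.toFun (((1 + t) / 2) • f' + ((1 - t) / 2) • f'') := by rw [← e3]
      _ ≤ φ.toFun (((1 + t) / 2) • f') + φ.toFun (((1 - t) / 2) • f'') := φ.add_le' _ _
      _ = (1 + t) / 2 * φ.toFun f' + (1 - t) / 2 * φ.toFun f' := by
        rw [φ.smul', φ.smul', e1, abs_of_nonneg (by linarith), abs_of_nonneg (by linarith)]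
      _ = φ.toFun f' := by ring
      _ ≤ φ.toFun g := e2

lemma toFun_mono {f g : ℕ →₀ ℝ} (h : ∀ i, |f i| ≤ |g i|) : φ.toFun f ≤ φ.toFun g := by
  classical
  refine φ.toFun_mono_aux (f.support ∪ g.support) f g h fun i hi => ?_
  simp only [Finset.mem_union, Finsupp.mem_support_iff, not_or, not_not] at hi
  rw [hi.1, hi.2]

/-- On the finite support the injection extends to a permutation of ℕ, both complements being
countably infinite. -/
lemma toFun_mapDomain {k : ℕ → ℕ} (hk : Function.Injective k) (f : ℕ →₀ ℝ) :
    φ.toFun (f.mapDomain k) = φ.toFun f := by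
  classical
  let e : (f.support : Set ℕ) ↪ ℕ := ⟨fun x => k x, hk.comp Subtype.val_injective⟩
  have h1 : (f.support : Set ℕ).Finite := f.support.finite_toSet
  have h2 : (Set.range e).Finite := Set.finite_range _
  have := h1.infinite_compl.to_subtype
  have := h2.infinite_compl.to_subtype
  obtain ⟨σ, hσ⟩ := Cardinal.extend_function e (nonempty_equiv_of_countable)
  rw [← φ.perm' σ f]
  congr 1
  rw [Finsupp.equivMapDomain_eq_mapDomain]
  exact Finsupp.mapDomain_congr fun x hx => (hσ ⟨x, hx⟩).symm

end SymmetricNormingFunction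

/-! ### The extended norm on arbitrary sequences -/

lemma truncSeq_apply (ξ : ℕ → ℝ) (n i : ℕ) : truncSeq ξ n i = if i < n then ξ i else 0 := by
  classical
  simp [truncSeq, Finsupp.finsetSum_apply, Finsupp.single_apply]

lemma truncSeq_add (ξ η : ℕ → ℝ) (n : ℕ) :
    truncSeq (ξ + η) n = truncSeq ξ n + truncSeq η n := by
  ext i
  simp only [truncSeq_apply, Finsupp.add_apply, Pi.add_apply]
  split_ifs <;> simp

lemma truncSeq_smul (c : ℝ) (ξ : ℕ → ℝ) (n : ℕ) : truncSeq (c • ξ) n = c • truncSeq ξ n := by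
  ext i
  simp [truncSeq_apply]

namespace SymmetricNormingFunction

variable (φ : SymmetricNormingFunction)

lemma toFun_truncSeq_le_ext (ξ : ℕ → ℝ) (n : ℕ) :
    ENNReal.ofReal (φ.toFun (truncSeq ξ n)) ≤ φ.ext ξ :=
  le_iSup (fun n : ℕ => ENNReal.ofReal (φ.toFun (truncSeq ξ n))) n

lemma toFun_truncSeq_mono {ξ η : ℕ → ℝ} {n : ℕ} (h : ∀ i < n, |ξ i| ≤ |η i|) :
    φ.toFun (truncSeq ξ n) ≤ φ.toFun (truncSeq η n) := by
  refine φ.toFun_mono fun i => ?_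
  simp only [truncSeq_apply]
  split_ifs with hi
  · exact h i hi
  · exact le_rfl

lemma toFun_truncSeq_monotone (ξ : ℕ → ℝ) : Monotone fun n => φ.toFun (truncSeq ξ n) := by
  intro m n hmn
  refine φ.toFun_mono fun i => ?_
  simp only [truncSeq_apply]
  split_ifs with h1 h2
  · exact le_rfl
  · omega
  · simp
  · exact le_rfl

lemma ext_mono {ξ η : ℕ → ℝ} (h : ∀ i, |ξ i| ≤ |η i|) : φ.ext ξ ≤ φ.ext η :=
  iSup_mono fun _ => ENNReal.ofReal_le_ofReal (φ.toFun_truncSeq_mono fun i _ => h i)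

lemma ext_add_le (ξ η : ℕ → ℝ) : φ.ext (ξ + η) ≤ φ.ext ξ + φ.ext η := by
  refine iSup_le fun n => ?_
  rw [truncSeq_add]
  calc _ ≤ ENNReal.ofReal (φ.toFun (truncSeq ξ n) + φ.toFun (truncSeq η n)) :=
        ENNReal.ofReal_le_ofReal (φ.add_le' _ _)
    _ ≤ _ := ENNReal.ofReal_add_le.trans
        (add_le_add (φ.toFun_truncSeq_le_ext ξ n) (φ.toFun_truncSeq_le_ext η n))

lemma ext_smul_le (c : ℝ) (ξ : ℕ → ℝ) : φ.ext (c • ξ) ≤ ENNReal.ofReal |c| * φ.ext ξ := by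
  refine iSup_le fun n => ?_
  rw [truncSeq_smul, φ.smul', ENNReal.ofReal_mul (abs_nonneg c)]
  gcongr
  exact φ.toFun_truncSeq_le_ext ξ n

/-- Repeating every entry twice at most doubles the norm. -/
lemma ext_dilate_le (ξ : ℕ → ℝ) : φ.ext (fun i => ξ (i / 2)) ≤ 2 * φ.ext ξ := by
  refine iSup_le fun n => ?_
  set f := truncSeq ξ n with hf
  have i0 : Function.Injective fun i : ℕ => 2 * i := fun a b h => by simpa using h
  have i1 : Function.Injective fun i : ℕ => 2 * i + 1 := fun a b h => by simpa using h
  set g := f.mapDomain (fun i => 2 * i) + f.mapDomain (fun i => 2 * i + 1) with hg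
  have h0 : ∀ i, g i = f (i / 2) := by
    intro i
    rcases Nat.even_or_odd' i with ⟨j, rfl | rfl⟩
    · rw [hg, Finsupp.add_apply, Finsupp.mapDomain_apply i0 f j, Finsupp.mapDomain_of_notMem_range]
      · simp
      · rintro ⟨k, hk⟩
        simp only at hk
        omega
    · rw [hg, Finsupp.add_apply, Finsupp.mapDomain_apply i1 f j, Finsupp.mapDomain_of_notMem_range]
      · rw [zero_add]
        congr 1
        omega
      · rintro ⟨k, hk⟩
        simp only at hk
        omega
  have h1 : φ.toFun (truncSeq (fun i => ξ (i / 2)) n) ≤ φ.toFun g := by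
    refine φ.toFun_mono fun i => ?_
    rw [h0, hf]
    simp only [truncSeq_apply]
    split_ifs with h1 h2
    · exact le_rfl
    · omega
    · simp
    · exact le_rfl
  have h2 : φ.toFun g ≤ φ.toFun f + φ.toFun f := by
    refine (φ.add_le' _ _).trans ?_
    rw [φ.toFun_mapDomain i0, φ.toFun_mapDomain i1]
  calc _ ≤ ENNReal.ofReal (φ.toFun f + φ.toFun f) := ENNReal.ofReal_le_ofReal (h1.trans h2)
    _ ≤ φ.ext ξ + φ.ext ξ := ENNReal.ofReal_add_le.trans
        (add_le_add (φ.toFun_truncSeq_le_ext ξ n) (φ.toFun_truncSeq_le_ext ξ n))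
    _ = _ := (two_mul _).symm

lemma ext_le_of_forall_ge_eq_zero {ξ : ℕ → ℝ} {n : ℕ} (h : ∀ i, n ≤ i → ξ i = 0) :
    φ.ext ξ ≤ ENNReal.ofReal (φ.toFun (truncSeq ξ n)) := by
  refine iSup_le fun m => ENNReal.ofReal_le_ofReal (φ.toFun_mono fun i => ?_)
  simp only [truncSeq_apply]
  split_ifs with h1 h2
  · exact le_rfl
  · rw [h i (by omega)]
  · simp
  · exact le_rfl

/-- The norm of the first unit vector. -/
noncomputable def unit : ℝ := φ.toFun (Finsupp.single 0 1)

lemma unit_pos : 0 < φ.unit := φ.pos' _ (by simp)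

lemma ofReal_abs_mul_unit_le_ext (ξ : ℕ → ℝ) : ENNReal.ofReal (|ξ 0| * φ.unit) ≤ φ.ext ξ := by
  refine le_trans (ENNReal.ofReal_le_ofReal ?_) (φ.toFun_truncSeq_le_ext ξ 1)
  rw [unit, ← φ.smul']
  simp [truncSeq]

/-- A form of lower semicontinuity under uniform approximation: on a fixed segment an error δ costs
only δ times the norm of a finite block of ones. -/
lemma ext_le_of_forall_approx {ξ : ℕ → ℝ} {C : ENNReal} (hξ : ∀ i, 0 ≤ ξ i)
    (h : ∀ δ : ℝ, 0 < δ → ∃ η : ℕ → ℝ, φ.ext η ≤ C ∧ ∀ i, ξ i ≤ η i + δ) : φ.ext ξ ≤ C := by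
  refine iSup_le fun n => ENNReal.le_of_forall_pos_le_add fun ε hε _ => ?_
  set c := φ.toFun (truncSeq 1 n) with hc
  have hc0 : 0 ≤ c := φ.toFun_nonneg _
  -- The summand 1 avoids division by zero, since c = 0 when n = 0.
  obtain ⟨η, hη, hle⟩ := h (ε / (c + 1)) (by positivity)
  have h1 : φ.toFun (truncSeq ξ n) ≤ φ.toFun (truncSeq η n) + ε / (c + 1) * c := by
    calc _ ≤ φ.toFun (truncSeq (η + ((ε : ℝ) / (c + 1)) • (1 : ℕ → ℝ)) n) := by
          refine φ.toFun_truncSeq_mono fun i _ => ?_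
          rw [abs_of_nonneg (hξ i)]
          refine le_trans ?_ (le_abs_self _)
          simpa using hle i
      _ ≤ _ := by
          rw [truncSeq_add, truncSeq_smul]
          refine (φ.add_le' _ _).trans ?_
          rw [φ.smul', abs_of_nonneg (by positivity : (0 : ℝ) ≤ ε / (c + 1))]
  have h2 : (ε : ℝ) / (c + 1) * c ≤ ε := by
    rw [div_mul_eq_mul_div, div_le_iff₀ (by positivity)]
    nlinarith [ε.2]
  calc _ ≤ ENNReal.ofReal (φ.toFun (truncSeq η n) + ε) :=
        ENNReal.ofReal_le_ofReal (h1.trans (by linarith))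
    _ ≤ ENNReal.ofReal (φ.toFun (truncSeq η n)) + ENNReal.ofReal ε := ENNReal.ofReal_add_le
    _ ≤ C + ε := by
        rw [ENNReal.ofReal_coe_nnreal]
        gcongr
        exact (φ.toFun_truncSeq_le_ext η n).trans hη

end SymmetricNormingFunction

/-! ### Sequence-level content of soft covers and strong soft-complementedness -/

lemma cZeroStar_nonneg {ξ : ℕ → ℝ} (h : ξ ∈ cZeroStar) (i : ℕ) : 0 ≤ ξ i :=
  h.1.le_of_tendsto h.2 i

lemma mul_mem_cZeroStar {α ξ : ℕ → ℝ} (hα : α ∈ cZeroStar) (hξ : ξ ∈ cZeroStar) :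
    α * ξ ∈ cZeroStar := by
  refine ⟨fun i j hij => ?_, by simpa using! hα.2.mul hξ.2⟩
  exact mul_le_mul (hα.1 hij) (hξ.1 hij) (cZeroStar_nonneg hξ _) (cZeroStar_nonneg hα _)

namespace SymmetricNormingFunction

variable (φ : SymmetricNormingFunction)

/-- The tail of αξ from n on is dominated by α n times ξ. -/
lemma mul_mem_minSet {α ξ : ℕ → ℝ} (hα : α ∈ cZeroStar) (hξ : ξ ∈ φ.maxSet) :
    α * ξ ∈ φ.minSet := by
  have key : ∀ n, φ.ext (fun i => (α * ξ) (n + i)) ≤ ENNReal.ofReal (α n) * φ.ext ξ := by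
    intro n
    have hn := cZeroStar_nonneg hα n
    rw [← abs_of_nonneg hn]
    refine le_trans (φ.ext_mono fun i => ?_) (φ.ext_smul_le _ _)
    rw [Pi.mul_apply, Pi.smul_apply, smul_eq_mul, abs_mul, abs_mul]
    rw [abs_of_nonneg hn, abs_of_nonneg (cZeroStar_nonneg hα _),
      abs_of_nonneg (cZeroStar_nonneg hξ.1 _), abs_of_nonneg (cZeroStar_nonneg hξ.1 _)]
    exact mul_le_mul (hα.1 (by omega)) (hξ.1.1 (by omega)) (cZeroStar_nonneg hξ.1 _) hn
  refine ⟨⟨mul_mem_cZeroStar hα hξ.1, ?_⟩, ?_⟩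
  · refine lt_of_le_of_lt ?_
      (ENNReal.mul_lt_top (ENNReal.ofReal_lt_top (r := α 0)) hξ.2)
    simpa using! key 0
  · refine tendsto_of_tendsto_of_tendsto_of_le_of_le tendsto_const_nhds ?_
      (fun _ => zero_le) key
    have := ENNReal.Tendsto.mul_const (b := φ.ext ξ)
      ((ENNReal.continuous_ofReal.tendsto 0).comp hα.2) (Or.inr hξ.2.ne)
    simpa using! this

/-- A sequence of infinite norm can be multiplied by a null sequence keeping the norm infinite. -/
lemma exists_ext_mul_eq_top {ξ : ℕ → ℝ} (hξ : φ.ext ξ = ⊤) :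
    ∃ α ∈ cZeroStar, φ.ext (α * ξ) = ⊤ := by
  set a : ℕ → ℝ := fun n => φ.toFun (truncSeq ξ n) with ha
  have a0 : ∀ n, 0 ≤ a n := fun n => φ.toFun_nonneg _
  have amono : Monotone a := φ.toFun_truncSeq_monotone ξ
  have atop : Filter.Tendsto a Filter.atTop Filter.atTop := by
    refine Filter.tendsto_atTop_atTop_of_monotone amono fun b => ?_
    by_contra! hb
    have : φ.ext ξ ≤ ENNReal.ofReal b :=
      iSup_le fun n => ENNReal.ofReal_le_ofReal (hb n).le
    rw [hξ] at this
    exact absurd this (by simp)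
  -- As α decreases, the n-th truncation of αξ has norm at least α n · a n, which is about √(a n)
  -- and still unbounded.
  set α : ℕ → ℝ := fun n => (√(1 + a n))⁻¹ with hα
  have hs : ∀ n, 0 < √(1 + a n) := fun n => Real.sqrt_pos.2 (by linarith [a0 n])
  have αanti : Antitone α := fun i j hij =>
    inv_anti₀ (hs i) (Real.sqrt_le_sqrt (by linarith [amono hij]))
  have sqrt_top : Filter.Tendsto (fun n => √(1 + a n)) Filter.atTop Filter.atTop :=
    Real.tendsto_sqrt_atTop.comp (Filter.tendsto_atTop_add_const_left _ _ atop)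
  refine ⟨α, ⟨αanti, sqrt_top.inv_tendsto_atTop⟩, ?_⟩
  have key : ∀ n, √(1 + a n) - 1 ≤ φ.toFun (truncSeq (α * ξ) n) := by
    intro n
    have h1 : φ.toFun (truncSeq (α n • ξ) n) ≤ φ.toFun (truncSeq (α * ξ) n) := by
      refine φ.toFun_truncSeq_mono fun i hi => ?_
      rw [Pi.mul_apply, Pi.smul_apply, smul_eq_mul, abs_mul, abs_mul]
      gcongr
      exact αanti hi.le
    refine le_trans ?_ h1
    rw [truncSeq_smul, φ.smul', abs_of_pos (inv_pos.2 (hs n)), inv_mul_eq_div,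
      le_div_iff₀ (hs n)]
    have h2 : √(1 + a n) * √(1 + a n) = 1 + a n := Real.mul_self_sqrt (by linarith [a0 n])
    have h3 : 1 ≤ √(1 + a n) := Real.one_le_sqrt.2 (by linarith [a0 n])
    change _ ≤ a n
    nlinarith
  refine ENNReal.eq_top_of_forall_nnreal_le fun r => ?_
  obtain ⟨n, hn⟩ := (sqrt_top.eventually_ge_atTop (r + 1)).exists
  refine le_trans ?_ (φ.toFun_truncSeq_le_ext _ n)
  rw [← ENNReal.ofReal_coe_nnreal]
  exact ENNReal.ofReal_le_ofReal (by linarith [key n])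

/-- Sequences of infinite norm can be detected on initial segments, uniformly along a sequence. -/
lemma exists_segments_ext_eq_top {η : ℕ → ℕ → ℝ} (hη : ∀ k, η k ∈ cZeroStar)
    (htop : ∀ k, φ.ext (η k) = ⊤) :
    ∃ n : ℕ → ℕ, ∀ ξ : ℕ → ℝ, (∀ k, ∀ i < n k, η k i ≤ ξ i) → φ.ext ξ = ⊤ := by
  -- Segment k has norm above k, so a sequence dominating all the segments has norm above every k.
  have : ∀ k : ℕ, ∃ n, (k : ENNReal) < ENNReal.ofReal (φ.toFun (truncSeq (η k) n)) := by
    intro k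
    have h : (k : ENNReal) < φ.ext (η k) := by rw [htop k]; exact ENNReal.natCast_lt_top k
    exact lt_iSup_iff.1 h
  choose n hn using this
  refine ⟨n, fun ξ h => ENNReal.eq_top_of_forall_nnreal_le fun r => ?_⟩
  obtain ⟨k, hk⟩ := exists_nat_ge r
  calc (r : ENNReal) ≤ (k : ENNReal) := by exact_mod_cast hk
    _ ≤ ENNReal.ofReal (φ.toFun (truncSeq (η k) (n k))) := (hn k).le
    _ ≤ ENNReal.ofReal (φ.toFun (truncSeq ξ (n k))) := by
      refine ENNReal.ofReal_le_ofReal (φ.toFun_truncSeq_mono fun i hi => ?_)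
      rw [abs_of_nonneg (cZeroStar_nonneg (hη k) i)]
      exact (h k i hi).trans (le_abs_self _)
    _ ≤ _ := φ.toFun_truncSeq_le_ext _ _

end SymmetricNormingFunction

/-! ### Inequalities for s-numbers -/

section SNumbers

variable {H : Type*} [NormedAddCommGroup H] [InnerProductSpace ℂ H]

lemma bddBelow_sNumbers_set (T : H →L[ℂ] H) (n : ℕ) :
    BddBelow {r : ℝ | ∃ F : H →L[ℂ] H,
      LinearMap.rank (F : H →ₗ[ℂ] H) ≤ (n : Cardinal) ∧ r = ‖T - F‖} :=
  ⟨0, by rintro _ ⟨F, -, rfl⟩; exact norm_nonneg _⟩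

lemma rank_zero_le (n : ℕ) :
    LinearMap.rank ((0 : H →L[ℂ] H) : H →ₗ[ℂ] H) ≤ (n : Cardinal) := by
  rw [ContinuousLinearMap.toLinearMap_zero, LinearMap.rank_zero]
  exact zero_le

lemma sNumbers_le {T F : H →L[ℂ] H} {n : ℕ}
    (hF : LinearMap.rank (F : H →ₗ[ℂ] H) ≤ (n : Cardinal)) : sNumbers T n ≤ ‖T - F‖ :=
  csInf_le (bddBelow_sNumbers_set T n) ⟨F, hF, rfl⟩

lemma exists_rank_le_norm_sub_lt (T : H →L[ℂ] H) (n : ℕ) {δ : ℝ} (hδ : 0 < δ) :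
    ∃ F : H →L[ℂ] H, LinearMap.rank (F : H →ₗ[ℂ] H) ≤ (n : Cardinal) ∧
      ‖T - F‖ < sNumbers T n + δ := by
  obtain ⟨_, ⟨F, hF, rfl⟩, hlt⟩ := exists_lt_of_csInf_lt
    (s := {r : ℝ | ∃ F : H →L[ℂ] H,
      LinearMap.rank (F : H →ₗ[ℂ] H) ≤ (n : Cardinal) ∧ r = ‖T - F‖})
    ⟨_, 0, rank_zero_le n, rfl⟩ (lt_add_of_pos_right (sNumbers T n) hδ)
  exact ⟨F, hF, hlt⟩

lemma sNumbers_nonneg (T : H →L[ℂ] H) (n : ℕ) : 0 ≤ sNumbers T n :=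
  Real.sInf_nonneg (by rintro _ ⟨F, -, rfl⟩; exact norm_nonneg _)

lemma sNumbers_antitone (T : H →L[ℂ] H) : Antitone (sNumbers T) := by
  intro m n hmn
  refine le_of_forall_pos_le_add fun δ hδ => ?_
  obtain ⟨F, hF, hlt⟩ := exists_rank_le_norm_sub_lt T m hδ
  exact (sNumbers_le (hF.trans (by exact_mod_cast hmn))).trans hlt.le

lemma rank_add_le_natCast {F G : H →L[ℂ] H} {m n : ℕ}
    (hF : LinearMap.rank (F : H →ₗ[ℂ] H) ≤ (m : Cardinal))
    (hG : LinearMap.rank (G : H →ₗ[ℂ] H) ≤ (n : Cardinal)) :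
    LinearMap.rank ((F + G : H →L[ℂ] H) : H →ₗ[ℂ] H) ≤ ((m + n : ℕ) : Cardinal) := by
  rw [ContinuousLinearMap.toLinearMap_add, Nat.cast_add]
  exact (LinearMap.rank_add_le _ _).trans (add_le_add hF hG)

lemma rank_mul_le_right {F : H →L[ℂ] H} {n : ℕ} (A : H →L[ℂ] H)
    (hF : LinearMap.rank (F : H →ₗ[ℂ] H) ≤ (n : Cardinal)) :
    LinearMap.rank ((A * F : H →L[ℂ] H) : H →ₗ[ℂ] H) ≤ (n : Cardinal) :=
  (LinearMap.rank_comp_le_right (F : H →ₗ[ℂ] H) (A : H →ₗ[ℂ] H)).trans hF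

lemma rank_mul_le_left {F : H →L[ℂ] H} {n : ℕ} (A : H →L[ℂ] H)
    (hF : LinearMap.rank (F : H →ₗ[ℂ] H) ≤ (n : Cardinal)) :
    LinearMap.rank ((F * A : H →L[ℂ] H) : H →ₗ[ℂ] H) ≤ (n : Cardinal) :=
  (LinearMap.rank_comp_le_left (A : H →ₗ[ℂ] H) (F : H →ₗ[ℂ] H)).trans hF

lemma sNumbers_add_le (S T : H →L[ℂ] H) (m n : ℕ) :
    sNumbers (S + T) (m + n) ≤ sNumbers S m + sNumbers T n := by
  refine le_of_forall_pos_le_add fun δ hδ => ?_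
  obtain ⟨F, hF, hlF⟩ := exists_rank_le_norm_sub_lt S m (half_pos hδ)
  obtain ⟨G, hG, hlG⟩ := exists_rank_le_norm_sub_lt T n (half_pos hδ)
  calc _ ≤ ‖S + T - (F + G)‖ := sNumbers_le (rank_add_le_natCast hF hG)
    _ ≤ ‖S - F‖ + ‖T - G‖ := by rw [add_sub_add_comm]; exact norm_add_le _ _
    _ ≤ _ := by linarith

lemma sNumbers_zero_right (T : H →L[ℂ] H) : sNumbers T 0 = ‖T‖ := by
  refine le_antisymm (by simpa using sNumbers_le (T := T) (rank_zero_le 0)) ?_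
  refine le_of_forall_pos_le_add fun δ hδ => ?_
  obtain ⟨F, hF, hlF⟩ := exists_rank_le_norm_sub_lt T 0 hδ
  have : LinearMap.range (F : H →ₗ[ℂ] H) = ⊥ := by
    rw [← Submodule.rank_eq_zero]
    simpa [LinearMap.rank] using hF
  have hF0 : F = 0 := by
    ext x
    have h := LinearMap.mem_range_self (F : H →ₗ[ℂ] H) x
    rw [this] at h
    simpa using h
  rw [hF0, sub_zero] at hlF
  exact hlF.le

lemma sNumbers_le_add_norm_sub (S T : H →L[ℂ] H) (n : ℕ) :
    sNumbers T n ≤ sNumbers S n + ‖T - S‖ := by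
  have := sNumbers_add_le S (T - S) n 0
  rwa [sNumbers_zero_right, add_zero, add_sub_cancel] at this

/-- Subtracting an operator of rank at most `m` shifts the `s`-numbers by at most `m`. -/
lemma sNumbers_add_rank_le {T F : H →L[ℂ] H} {m : ℕ} (n : ℕ)
    (hF : LinearMap.rank (F : H →ₗ[ℂ] H) ≤ (m : Cardinal)) :
    sNumbers T (n + m) ≤ sNumbers (T - F) n := by
  have h := sNumbers_add_le (T - F) F n m
  have h0 : sNumbers F m ≤ 0 := by simpa using sNumbers_le (T := F) hF
  rw [sub_add_cancel] at h
  linarith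

lemma sNumbers_neg (T : H →L[ℂ] H) : sNumbers (-T) = sNumbers T := by
  have key : ∀ S : H →L[ℂ] H, ∀ n, sNumbers (-S) n ≤ sNumbers S n := by
    intro S n
    refine le_of_forall_pos_le_add fun δ hδ => ?_
    obtain ⟨F, hF, hlF⟩ := exists_rank_le_norm_sub_lt S n hδ
    have h := rank_mul_le_right (-1) hF
    calc _ ≤ ‖-S - (-1) * F‖ := sNumbers_le h
      _ = ‖S - F‖ := by rw [neg_one_mul, ← norm_neg]; congr 1; abel
      _ ≤ _ := hlF.le
  funext n
  refine le_antisymm (key T n) ?_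
  simpa using key (-T) n

lemma sNumbers_mul_le_left (A T : H →L[ℂ] H) (n : ℕ) :
    sNumbers (A * T) n ≤ ‖A‖ * sNumbers T n := by
  refine le_of_forall_pos_le_add fun δ hδ => ?_
  obtain ⟨F, hF, hlF⟩ := exists_rank_le_norm_sub_lt T n
    (δ := δ / (‖A‖ + 1)) (by positivity)
  have h2 : ‖A‖ * (δ / (‖A‖ + 1)) ≤ δ := by
    rw [← mul_div_assoc, div_le_iff₀ (by positivity)]
    nlinarith
  calc _ ≤ ‖A * T - A * F‖ := sNumbers_le (rank_mul_le_right A hF)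
    _ ≤ ‖A‖ * ‖T - F‖ := by rw [← mul_sub]; exact norm_mul_le _ _
    _ ≤ ‖A‖ * (sNumbers T n + δ / (‖A‖ + 1)) := by gcongr
    _ ≤ _ := by rw [mul_add]; linarith

lemma sNumbers_mul_le_right (T A : H →L[ℂ] H) (n : ℕ) :
    sNumbers (T * A) n ≤ ‖A‖ * sNumbers T n := by
  refine le_of_forall_pos_le_add fun δ hδ => ?_
  obtain ⟨F, hF, hlF⟩ := exists_rank_le_norm_sub_lt T n
    (δ := δ / (‖A‖ + 1)) (by positivity)
  have h2 : ‖A‖ * (δ / (‖A‖ + 1)) ≤ δ := by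
    rw [← mul_div_assoc, div_le_iff₀ (by positivity)]
    nlinarith
  calc _ ≤ ‖T * A - F * A‖ := sNumbers_le (rank_mul_le_left A hF)
    _ ≤ ‖T - F‖ * ‖A‖ := by rw [← sub_mul]; exact norm_mul_le _ _
    _ ≤ (sNumbers T n + δ / (‖A‖ + 1)) * ‖A‖ := by gcongr
    _ ≤ _ := by rw [add_mul, mul_comm _ ‖A‖, mul_comm _ ‖A‖]; linarith

/-- Operators with finite-dimensional range. -/
def HasFiniteRank (F : H →L[ℂ] H) : Prop :=
  ∃ n : ℕ, LinearMap.rank (F : H →ₗ[ℂ] H) ≤ (n : Cardinal)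

/-! ### Finite-rank and compact operators -/

namespace HasFiniteRank

lemma zero : HasFiniteRank (0 : H →L[ℂ] H) := ⟨0, rank_zero_le 0⟩

lemma add {F G : H →L[ℂ] H} (hF : HasFiniteRank F) (hG : HasFiniteRank G) :
    HasFiniteRank (F + G) := by
  obtain ⟨m, hm⟩ := hF
  obtain ⟨n, hn⟩ := hG
  exact ⟨m + n, rank_add_le_natCast hm hn⟩

lemma mul_left {F : H →L[ℂ] H} (hF : HasFiniteRank F) (A : H →L[ℂ] H) : HasFiniteRank (A * F) :=
  hF.imp fun _ h => rank_mul_le_right A h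

lemma mul_right {F : H →L[ℂ] H} (hF : HasFiniteRank F) (A : H →L[ℂ] H) : HasFiniteRank (F * A) :=
  hF.imp fun _ h => rank_mul_le_left A h

lemma finiteDimensional_range {F : H →L[ℂ] H} (hF : HasFiniteRank F) :
    FiniteDimensional ℂ (LinearMap.range (F : H →ₗ[ℂ] H)) := by
  obtain ⟨n, hn⟩ := hF
  exact Module.rank_lt_aleph0_iff.1 (hn.trans_lt (Cardinal.natCast_lt_aleph0))

lemma of_range_le {F : H →L[ℂ] H} {K : Submodule ℂ H} [FiniteDimensional ℂ K]
    (h : LinearMap.range (F : H →ₗ[ℂ] H) ≤ K) : HasFiniteRank F := by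
  refine ⟨Module.finrank ℂ K, ?_⟩
  rw [Module.finrank_eq_rank]
  exact Submodule.rank_mono h

lemma starProjection (K : Submodule ℂ H) [FiniteDimensional ℂ K] :
    HasFiniteRank K.starProjection := by
  refine of_range_le (K := K) ?_
  rintro _ ⟨x, rfl⟩
  exact K.starProjection_apply_mem x

lemma isCompactOperator {F : H →L[ℂ] H} (hF : HasFiniteRank F) : IsCompactOperator F := by
  have := hF.finiteDimensional_range
  let G : H →L[ℂ] LinearMap.range (F : H →ₗ[ℂ] H) :=
    F.codRestrict _ fun x => LinearMap.mem_range_self _ x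
  have : ProperSpace (LinearMap.range (F : H →ₗ[ℂ] H)) := FiniteDimensional.proper ℂ _
  exact (isCompactOperator_of_locallyCompactSpace_dom G).clm_comp (Submodule.subtypeL _)

end HasFiniteRank

/-- T is projected onto the span of a finite ε-net for the image of the unit ball; the orthogonal
projection approximates at least as well as the net. -/
lemma IsCompactOperator.exists_hasFiniteRank_norm_sub_le {T : H →L[ℂ] H}
    (hT : IsCompactOperator T) {ε : ℝ} (hε : 0 < ε) :
    ∃ F : H →L[ℂ] H, HasFiniteRank F ∧ ‖T - F‖ ≤ ε := by
  obtain ⟨C, hC, hsub⟩ :=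
    IsCompactOperator.image_closedBall_subset_compact (f := (T : H →ₗ[ℂ] H)) hT 1
  obtain ⟨t, -, ht, hcov⟩ := hC.finite_cover_balls hε
  have : FiniteDimensional ℂ (Submodule.span ℂ t) := FiniteDimensional.span_of_finite ℂ ht
  set K := Submodule.span ℂ t
  refine ⟨K.starProjection * T, (HasFiniteRank.starProjection K).mul_right T, ?_⟩
  refine ContinuousLinearMap.opNorm_le_of_unit_norm hε.le fun x hx => ?_
  have hx' : T x ∈ C := hsub ⟨x, by simp [hx], rfl⟩
  obtain ⟨y, hy, hlt⟩ := Set.mem_iUnion₂.1 (hcov hx')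
  have hmin := K.starProjection_minimal (T x)
  calc ‖(T - K.starProjection * T) x‖ = ‖T x - K.starProjection (T x)‖ := rfl
    _ ≤ ‖T x - y‖ := by
      rw [hmin]
      exact ciInf_le (f := fun z : K => ‖T x - z‖)
        ⟨0, by rintro _ ⟨z, rfl⟩; exact norm_nonneg _⟩ ⟨y, Submodule.subset_span hy⟩
    _ ≤ ε := by rw [← dist_eq_norm]; exact (Metric.mem_ball.1 hlt).le

lemma isCompactOperator_of_forall_hasFiniteRank [CompleteSpace H] {T : H →L[ℂ] H}
    (h : ∀ ε : ℝ, 0 < ε → ∃ F : H →L[ℂ] H, HasFiniteRank F ∧ ‖T - F‖ ≤ ε) :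
    IsCompactOperator T := by
  have hcl : IsClosed {S : H →L[ℂ] H | IsCompactOperator S} :=
    isClosed_setOfPred_isCompactOperator
  refine hcl.closure_subset (Metric.mem_closure_iff.2 fun ε hε => ?_)
  obtain ⟨F, hF, hle⟩ := h (ε / 2) (half_pos hε)
  exact ⟨F, hF.isCompactOperator, by rw [dist_eq_norm]; linarith⟩

lemma IsCompactOperator.sNumbers_mem_cZeroStar {T : H →L[ℂ] H} (hT : IsCompactOperator T) :
    sNumbers T ∈ cZeroStar := by
  refine ⟨sNumbers_antitone T, Metric.tendsto_atTop.2 fun ε hε => ?_⟩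
  obtain ⟨F, ⟨m, hm⟩, hle⟩ := hT.exists_hasFiniteRank_norm_sub_le (half_pos hε)
  refine ⟨m, fun n hn => ?_⟩
  rw [Real.dist_0_eq_abs, abs_of_nonneg (sNumbers_nonneg T n)]
  have := (sNumbers_antitone T hn).trans ((sNumbers_le hm).trans hle)
  linarith

/-! ### Diagonal operators with prescribed s-numbers -/

lemma Orthonormal.norm_sq_sum_smul {ι : Type*} {e : ι → H} (he : Orthonormal ℂ e) (s : Finset ι)
    (c : ι → ℂ) : ‖∑ i ∈ s, c i • e i‖ ^ 2 = ∑ i ∈ s, ‖c i‖ ^ 2 := by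
  have h := he.inner_sum c c s
  rw [inner_self_eq_norm_sq_to_K] at h
  have h' : ((‖∑ i ∈ s, c i • e i‖ ^ 2 : ℝ) : ℂ) = ((∑ i ∈ s, ‖c i‖ ^ 2 : ℝ) : ℂ) := by
    push_cast
    refine h.trans (Finset.sum_congr rfl fun i _ => ?_)
    exact RCLike.conj_mul (c i)
  exact_mod_cast h'

/-- Every sequence in `c₀*` is the sequence of `s`-numbers of a compact operator, diagonal with
respect to an orthonormal sequence. -/
lemma Orthonormal.exists_sNumbers_eq [CompleteSpace H] {e : ℕ → H} (he : Orthonormal ℂ e)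
    {ξ : ℕ → ℝ} (hξ : ξ ∈ cZeroStar) :
    ∃ T : H →L[ℂ] H, IsCompactOperator T ∧ sNumbers T = ξ := by
  classical
  have ξ0 := cZeroStar_nonneg hξ
  let P : ℕ → H →L[ℂ] H := fun n =>
    ∑ i ∈ Finset.range n, (innerSL ℂ (e i)).smulRight ((ξ i : ℂ) • e i)
  have hP : ∀ n x, P n x = ∑ i ∈ Finset.range n, ((ξ i : ℂ) * inner ℂ (e i) x) • e i := by
    intro n x
    simp only [P, sum_apply, ContinuousLinearMap.smulRight_apply,
      innerSL_apply_apply, smul_smul, mul_comm]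
  -- Bessel's inequality, the coefficients from index m on being at most ξ m.
  have tail : ∀ m n, m ≤ n → ‖P n - P m‖ ≤ ξ m := by
    intro m n hmn
    refine ContinuousLinearMap.opNorm_le_bound _ (ξ0 m) fun x => ?_
    rw [sub_apply, hP, hP, ← Finset.sum_Ico_eq_sub _ hmn]
    refine (le_abs_self _).trans (abs_le_of_sq_le_sq ?_ (by have := ξ0 m; positivity))
    rw [he.norm_sq_sum_smul, mul_pow]
    calc _ ≤ ∑ i ∈ Finset.Ico m n, ξ m ^ 2 * ‖inner ℂ (e i) x‖ ^ 2 := by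
          refine Finset.sum_le_sum fun i hi => ?_
          rw [norm_mul, mul_pow, Complex.norm_real, Real.norm_of_nonneg (ξ0 i)]
          gcongr
          · exact ξ0 i
          · exact hξ.1 (Finset.mem_Ico.1 hi).1
      _ ≤ _ := by
          rw [← Finset.mul_sum]
          gcongr
          exact he.sum_inner_products_le x
  have cau : CauchySeq P := by
    refine cauchySeq_of_le_tendsto_0 (fun n => 2 * ξ n) (fun n m N hn hm => ?_) (by
      simpa using hξ.2.const_mul 2)
    rw [dist_eq_norm]
    calc ‖P n - P m‖ = ‖(P n - P N) - (P m - P N)‖ := by congr 1; abel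
      _ ≤ _ := (norm_sub_le _ _).trans (by linarith [tail N n hn, tail N m hm])
  obtain ⟨T, hT⟩ := cauchySeq_tendsto_of_complete cau
  have hTP : ∀ m, ‖T - P m‖ ≤ ξ m := fun m =>
    le_of_tendsto (hT.sub_const (P m)).norm
      ((Filter.eventually_ge_atTop m).mono fun n hn => tail m n hn)
  have rk : ∀ n, LinearMap.rank (P n : H →ₗ[ℂ] H) ≤ (n : Cardinal) := by
    intro n
    have h1 : LinearMap.range (P n : H →ₗ[ℂ] H) ≤
        Submodule.span ℂ ((Finset.range n).image e : Set H) := by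
      rintro _ ⟨x, rfl⟩
      rw [ContinuousLinearMap.coe_coe, hP]
      exact Submodule.sum_mem _ fun i hi => Submodule.smul_mem _ _
        (Submodule.subset_span (Finset.mem_coe.2 (Finset.mem_image_of_mem e hi)))
    refine (Submodule.rank_mono h1).trans ((rank_span_finset_le _).trans ?_)
    exact_mod_cast (Finset.card_image_le.trans (Finset.card_range n).le)
  have hTe : ∀ i, T (e i) = (ξ i : ℂ) • e i := by
    intro i
    have h1 : Filter.Tendsto (fun n => P n (e i)) Filter.atTop (nhds (T (e i))) :=
      ((ContinuousLinearMap.apply ℂ H (e i)).continuous.tendsto T).comp hT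
    refine tendsto_nhds_unique h1 (tendsto_const_nhds.congr' ?_)
    filter_upwards [Filter.eventually_gt_atTop i] with n hn
    rw [hP, Finset.sum_eq_single i]
    · simp [inner_self_eq_norm_sq_to_K, he.norm_eq_one i]
    · intro j _ hji
      rw [he.inner_eq_zero hji]
      simp
    · intro h
      exact absurd (Finset.mem_range.2 hn) h
  refine ⟨T, isCompactOperator_of_forall_hasFiniteRank fun ε hε => ?_, ?_⟩
  · obtain ⟨n, hn⟩ := (hξ.2.eventually_le_const hε).exists
    exact ⟨P n, ⟨n, rk n⟩, (hTP n).trans hn⟩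
  funext n
  -- The upper bound uses P n. For the lower one, an F of rank at most n has a kernel vector in the
  -- span of the first n + 1 basis vectors, where T stretches by at least ξ n.
  refine le_antisymm ((sNumbers_le (rk n)).trans (hTP n)) ?_
  refine le_of_forall_pos_le_add fun δ hδ => ?_
  obtain ⟨F, hF, hlF⟩ := exists_rank_le_norm_sub_lt T n hδ
  refine le_trans ?_ hlF.le
  -- a nonzero combination of `e 0, …, e n` killed by `F`
  let g : (Fin (n + 1) → ℂ) →ₗ[ℂ] H := Fintype.linearCombination ℂ (fun i : Fin (n + 1) => e i)
  have hfd : FiniteDimensional ℂ (LinearMap.range (F : H →ₗ[ℂ] H)) :=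
    HasFiniteRank.finiteDimensional_range ⟨n, hF⟩
  have hker := LinearMap.ker_ne_bot_of_finrank_lt
    (f := (F : H →ₗ[ℂ] H).rangeRestrict ∘ₗ g) (by
      rw [Module.finrank_fin_fun]
      refine Nat.lt_succ_of_le ?_
      have : (Module.finrank ℂ (LinearMap.range (F : H →ₗ[ℂ] H)) : Cardinal) ≤ n := by
        rw [Module.finrank_eq_rank]; exact hF
      exact_mod_cast this)
  obtain ⟨c, hc, hc0⟩ := Submodule.exists_mem_ne_zero_of_ne_bot hker
  have hFc : F (g c) = 0 := congrArg Subtype.val (LinearMap.mem_ker.1 hc)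
  have hsumFin : ∀ d : Fin (n + 1) → ℂ, ‖∑ i, d i • e i‖ ^ 2 = ∑ i, ‖d i‖ ^ 2 :=
    (he.comp _ Fin.val_injective).norm_sq_sum_smul Finset.univ
  have hg : g c = ∑ i, c i • e i := by simp [g, Fintype.linearCombination_apply]
  have hgpos : 0 < ‖g c‖ := by
    have : 0 < ‖g c‖ ^ 2 := by
      rw [hg, hsumFin]
      obtain ⟨i, hi⟩ := Function.ne_iff.1 hc0
      refine Finset.sum_pos' (fun _ _ => by positivity) ⟨i, Finset.mem_univ _, ?_⟩
      have : 0 < ‖c i‖ := norm_pos_iff.2 hi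
      positivity
    exact (sq_pos_iff.1 this).lt_of_le' (norm_nonneg _)
  have hTg : T (g c) = ∑ i : Fin (n + 1), ((ξ i : ℂ) * c i) • e i := by
    rw [hg, map_sum]
    refine Finset.sum_congr rfl fun i _ => ?_
    rw [map_smul, hTe, smul_smul, mul_comm]
  have hlow : ξ n * ‖g c‖ ≤ ‖T (g c)‖ := by
    refine (le_abs_self _).trans (abs_le_of_sq_le_sq ?_ (norm_nonneg _))
    rw [hTg, hsumFin, mul_pow, hg, hsumFin, Finset.mul_sum]
    refine Finset.sum_le_sum fun i _ => ?_
    rw [norm_mul, mul_pow, Complex.norm_real, Real.norm_of_nonneg (ξ0 i)]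
    gcongr
    · exact ξ0 n
    · exact hξ.1 (Nat.lt_succ_iff.1 i.2)
  have hup : ‖T (g c)‖ ≤ ‖T - F‖ * ‖g c‖ := by
    have := (T - F).le_opNorm (g c)
    rwa [sub_apply, hFc, sub_zero] at this
  exact le_of_mul_le_mul_right (hlow.trans hup) hgpos

lemma exists_orthonormal_nat [CompleteSpace H] (hH : ¬ FiniteDimensional ℂ H) :
    ∃ e : ℕ → H, Orthonormal ℂ e := by
  obtain ⟨w, b, -⟩ := exists_hilbertBasis ℂ H
  rcases finite_or_infinite w with hw | hw
  · have := Fintype.ofFinite w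
    exact absurd b.toOrthonormalBasis.toBasis.finiteDimensional_of_finite hH
  · exact ⟨_, b.orthonormal.comp _ (Infinite.natEmbedding w).injective⟩

end SNumbers

/-! ### The quasi-norm φ(s(T)) -/

section IdealNorm

open Filter Topology

variable {H : Type*} [NormedAddCommGroup H] [InnerProductSpace ℂ H]

namespace SymmetricNormingFunction

variable (φ : SymmetricNormingFunction)

/-- The (possibly infinite) quasi-norm `φ(s(T))` of an operator. -/
noncomputable def opExt (T : H →L[ℂ] H) : ENNReal := φ.ext (sNumbers T)

lemma opExt_le_of_forall_le {S T : H →L[ℂ] H} {c : ℝ} (hc : 0 ≤ c)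
    (h : ∀ n, sNumbers S n ≤ c * sNumbers T n) : φ.opExt S ≤ ENNReal.ofReal c * φ.opExt T := by
  refine le_trans (φ.ext_mono (η := c • sNumbers T) fun i => ?_) ?_
  · rw [abs_of_nonneg (sNumbers_nonneg S i)]
    exact (h i).trans (le_abs_self _)
  · simpa only [abs_of_nonneg hc] using! φ.ext_smul_le c (sNumbers T)

lemma opExt_mul_le_left (A T : H →L[ℂ] H) :
    φ.opExt (A * T) ≤ ENNReal.ofReal ‖A‖ * φ.opExt T :=
  φ.opExt_le_of_forall_le (norm_nonneg A) (sNumbers_mul_le_left A T)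

lemma opExt_mul_le_right (T A : H →L[ℂ] H) :
    φ.opExt (T * A) ≤ ENNReal.ofReal ‖A‖ * φ.opExt T :=
  φ.opExt_le_of_forall_le (norm_nonneg A) (sNumbers_mul_le_right T A)

lemma opExt_smul_le (c : ℂ) (T : H →L[ℂ] H) :
    φ.opExt (c • T) ≤ ENNReal.ofReal ‖c‖ * φ.opExt T := by
  refine φ.opExt_le_of_forall_le (norm_nonneg c) fun n => ?_
  have h := sNumbers_mul_le_left (c • (1 : H →L[ℂ] H)) T n
  rw [smul_mul_assoc, one_mul] at h
  refine h.trans (mul_le_mul_of_nonneg_right ?_ (sNumbers_nonneg T n))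
  rw [norm_smul]
  exact mul_le_of_le_one_right (norm_nonneg c) ContinuousLinearMap.norm_id_le

lemma opExt_neg (T : H →L[ℂ] H) : φ.opExt (-T) = φ.opExt T := by
  rw [opExt, sNumbers_neg, opExt]

lemma opExt_add_le (S T : H →L[ℂ] H) : φ.opExt (S + T) ≤ 2 * (φ.opExt S + φ.opExt T) := by
  calc φ.opExt (S + T) ≤ φ.ext (fun i => (sNumbers S + sNumbers T) (i / 2)) := by
        refine φ.ext_mono fun i => ?_
        rw [abs_of_nonneg (sNumbers_nonneg _ i)]
        refine le_trans ?_ (le_abs_self _)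
        refine (sNumbers_antitone (S + T) (by omega : i / 2 + i / 2 ≤ i)).trans ?_
        exact sNumbers_add_le S T _ _
    _ ≤ 2 * φ.ext (sNumbers S + sNumbers T) := φ.ext_dilate_le _
    _ ≤ _ := by gcongr; exact φ.ext_add_le _ _

lemma opExt_lt_top_of_hasFiniteRank {F : H →L[ℂ] H} (hF : HasFiniteRank F) : φ.opExt F < ⊤ := by
  obtain ⟨m, hm⟩ := hF
  refine lt_of_le_of_lt (φ.ext_le_of_forall_ge_eq_zero (n := m) fun i hi => ?_)
    ENNReal.ofReal_lt_top
  refine le_antisymm ((sNumbers_antitone F hi).trans ?_) (sNumbers_nonneg F i)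
  simpa using sNumbers_le (T := F) hm

/-- The quasi-norm controls the operator norm, so quasi-norm limits of finite-rank operators are
compact. -/
lemma ofReal_norm_mul_unit_le_opExt (T : H →L[ℂ] H) :
    ENNReal.ofReal (‖T‖ * φ.unit) ≤ φ.opExt T := by
  have := φ.ofReal_abs_mul_unit_le_ext (sNumbers T)
  rwa [sNumbers_zero_right, abs_norm] at this

lemma norm_le_of_opExt_le {T : H →L[ℂ] H} {c : ℝ} (hc : 0 ≤ c)
    (h : φ.opExt T ≤ ENNReal.ofReal c) : ‖T‖ ≤ c / φ.unit := by
  rw [le_div_iff₀ φ.unit_pos]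
  exact (ENNReal.ofReal_le_ofReal_iff hc).1 ((φ.ofReal_norm_mul_unit_le_opExt T).trans h)

lemma opExt_le_of_tendsto {S : ℕ → H →L[ℂ] H} {T : H →L[ℂ] H} {C : ENNReal}
    (hS : Tendsto S atTop (𝓝 T)) (h : ∀ n, φ.opExt (S n) ≤ C) : φ.opExt T ≤ C := by
  refine φ.ext_le_of_forall_approx (sNumbers_nonneg T) fun δ hδ => ?_
  obtain ⟨n, hn⟩ := (Metric.tendsto_nhds.1 hS δ hδ).exists
  refine ⟨sNumbers (S n), h n, fun i => (sNumbers_le_add_norm_sub (S n) T i).trans ?_⟩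
  rw [dist_comm, dist_eq_norm] at hn
  linarith

/-- Decay by 1/4 beats the constant 2: without its first term the series satisfies the hypothesis
with c/4, and 2(c + 4 · c/4) = 4c reproduces the bound. -/
lemma opExt_sum_range_le (m : ℕ) : ∀ (B : ℕ → H →L[ℂ] H) (c : ℝ), 0 ≤ c →
    (∀ j, φ.opExt (B j) ≤ ENNReal.ofReal (c * (1 / 4) ^ j)) →
    φ.opExt (∑ j ∈ Finset.range m, B j) ≤ ENNReal.ofReal (4 * c) := by
  induction m with
  | zero =>
    intro B c _ _
    rw [Finset.sum_range_zero]
    refine le_trans (φ.opExt_le_of_forall_le (T := B 0) le_rfl fun n => ?_) (by simp)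
    rw [zero_mul]
    simpa using sNumbers_le (T := (0 : H →L[ℂ] H)) (rank_zero_le n)
  | succ m ih =>
    intro B c hc h
    rw [Finset.sum_range_succ']
    have h1 := ih (fun j => B (j + 1)) (c / 4) (by positivity) fun j =>
      (h (j + 1)).trans_eq (by congr 1; ring)
    have h2 := h 0
    rw [pow_zero, mul_one] at h2
    refine (φ.opExt_add_le _ _).trans ((mul_le_mul_right (add_le_add h1 h2) 2).trans_eq ?_)
    rw [← ENNReal.ofReal_add (by positivity) hc, ← ENNReal.ofReal_ofNat,
      ← ENNReal.ofReal_mul (by norm_num)]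
    congr 1
    ring

/-- Operators that are approximated by finite-rank operators in the quasi-norm of `φ`. -/
def IsApproximable (T : H →L[ℂ] H) : Prop :=
  ∃ F : ℕ → H →L[ℂ] H, (∀ n, HasFiniteRank (F n)) ∧
    Tendsto (fun n => φ.opExt (T - F n)) atTop (𝓝 0)

variable {φ}

lemma tendsto_zero_of_le {u v : ℕ → ENNReal} (hv : Tendsto v atTop (𝓝 0))
    (h : ∀ n, u n ≤ v n) : Tendsto u atTop (𝓝 0) :=
  tendsto_of_tendsto_of_tendsto_of_le_of_le tendsto_const_nhds hv (fun _ => zero_le) h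

lemma tendsto_two_mul_add {u v : ℕ → ENNReal} (hu : Tendsto u atTop (𝓝 0))
    (hv : Tendsto v atTop (𝓝 0)) : Tendsto (fun n => 2 * (u n + v n)) atTop (𝓝 0) := by
  simpa using ENNReal.Tendsto.const_mul (a := 2) (hu.add hv) (Or.inr (by simp))

/-! ### Operators approximable by finite rank -/

namespace IsApproximable

lemma of_hasFiniteRank {F : H →L[ℂ] H} (hF : HasFiniteRank F) : φ.IsApproximable F := by
  refine ⟨fun _ => F, fun _ => hF, ?_⟩
  have h := φ.opExt_smul_le 0 (0 : H →L[ℂ] H)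
  rw [smul_zero, norm_zero, ENNReal.ofReal_zero, zero_mul, nonpos_iff_eq_zero] at h
  simp only [sub_self, h]
  exact tendsto_const_nhds

lemma add {S T : H →L[ℂ] H} (hS : φ.IsApproximable S) (hT : φ.IsApproximable T) :
    φ.IsApproximable (S + T) := by
  obtain ⟨F, hF, hF'⟩ := hS
  obtain ⟨G, hG, hG'⟩ := hT
  refine ⟨fun n => F n + G n, fun n => (hF n).add (hG n),
    tendsto_zero_of_le (tendsto_two_mul_add hF' hG') fun n => ?_⟩
  rw [add_sub_add_comm]
  exact φ.opExt_add_le _ _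

lemma mul_left {T : H →L[ℂ] H} (hT : φ.IsApproximable T) (A : H →L[ℂ] H) :
    φ.IsApproximable (A * T) := by
  obtain ⟨F, hF, hF'⟩ := hT
  refine ⟨fun n => A * F n, fun n => (hF n).mul_left A, tendsto_zero_of_le
    (v := fun n => ENNReal.ofReal ‖A‖ * φ.opExt (T - F n)) ?_ fun n => ?_⟩
  · have := ENNReal.Tendsto.const_mul hF' (Or.inr (ENNReal.ofReal_ne_top (r := ‖A‖)))
    rwa [mul_zero] at this
  · rw [← mul_sub]
    exact φ.opExt_mul_le_left _ _

lemma mul_right {T : H →L[ℂ] H} (hT : φ.IsApproximable T) (A : H →L[ℂ] H) :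
    φ.IsApproximable (T * A) := by
  obtain ⟨F, hF, hF'⟩ := hT
  refine ⟨fun n => F n * A, fun n => (hF n).mul_right A, tendsto_zero_of_le
    (v := fun n => ENNReal.ofReal ‖A‖ * φ.opExt (T - F n)) ?_ fun n => ?_⟩
  · have := ENNReal.Tendsto.const_mul hF' (Or.inr (ENNReal.ofReal_ne_top (r := ‖A‖)))
    rwa [mul_zero] at this
  · rw [← sub_mul]
    exact φ.opExt_mul_le_right _ _

lemma smul {T : H →L[ℂ] H} (hT : φ.IsApproximable T) (c : ℂ) : φ.IsApproximable (c • T) := by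
  simpa using hT.mul_left (c • 1)

lemma sum {ι : Type*} {s : Finset ι} {B : ι → H →L[ℂ] H}
    (h : ∀ i ∈ s, φ.IsApproximable (B i)) : φ.IsApproximable (∑ i ∈ s, B i) :=
  Finset.sum_induction _ _ (fun _ _ => add) (of_hasFiniteRank HasFiniteRank.zero) h

lemma isCompactOperator [CompleteSpace H] {T : H →L[ℂ] H} (hT : φ.IsApproximable T) :
    IsCompactOperator T := by
  obtain ⟨F, hF, hF'⟩ := hT
  refine isCompactOperator_of_forall_hasFiniteRank fun ε hε => ?_
  have hpos : 0 < ε * φ.unit := mul_pos hε φ.unit_pos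
  obtain ⟨n, hn⟩ := (hF'.eventually_le_const (ENNReal.ofReal_pos.2 hpos)).exists
  refine ⟨F n, hF n, (φ.norm_le_of_opExt_le hpos.le hn).trans_eq ?_⟩
  rw [mul_div_cancel_right₀ _ φ.unit_pos.ne']

lemma opExt_lt_top {T : H →L[ℂ] H} (hT : φ.IsApproximable T) : φ.opExt T < ⊤ := by
  obtain ⟨F, hF, hF'⟩ := hT
  obtain ⟨n, hn⟩ := (hF'.eventually_lt_const ENNReal.zero_lt_top).exists
  have h := φ.opExt_add_le (T - F n) (F n)
  rw [sub_add_cancel] at h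
  exact h.trans_lt (ENNReal.mul_lt_top (by simp)
    (ENNReal.add_lt_top.2 ⟨hn, φ.opExt_lt_top_of_hasFiniteRank (hF n)⟩))

/-- If F has rank at most m, the tail of s(T) from any k ≥ m on is dominated by s(T - F). -/
lemma sNumbers_mem_minSet [CompleteSpace H] {T : H →L[ℂ] H} (hT : φ.IsApproximable T) :
    sNumbers T ∈ φ.minSet := by
  refine ⟨⟨hT.isCompactOperator.sNumbers_mem_cZeroStar, hT.opExt_lt_top⟩, ?_⟩
  obtain ⟨F, hF, hF'⟩ := hT
  refine ENNReal.tendsto_nhds_zero.2 fun ε hε => ?_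
  obtain ⟨n, hn⟩ := (hF'.eventually_le_const hε).exists
  obtain ⟨m, hm⟩ := hF n
  filter_upwards [eventually_ge_atTop m] with k hk
  refine le_trans (φ.ext_mono fun i => ?_) hn
  rw [abs_of_nonneg (sNumbers_nonneg _ _), abs_of_nonneg (sNumbers_nonneg _ _)]
  exact (sNumbers_antitone T (by omega)).trans (sNumbers_add_rank_le i hm)

/-- Nearly optimal approximants of rank 2n replace a singular value decomposition. Up to a small
error, s(T - F n) is dominated by the tail of s(T) from n on with each entry repeated four times,
which costs a factor 4. -/
lemma of_sNumbers_mem_minSet {T : H →L[ℂ] H} (hT : sNumbers T ∈ φ.minSet) :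
    φ.IsApproximable T := by
  set c : ℕ → ℝ := fun n => φ.toFun (truncSeq 1 (4 * n)) with hc
  have c0 : ∀ n, 0 ≤ c n := fun n => φ.toFun_nonneg _
  -- The slack δ n matters only at the first 4n indices, where its norm is at most δ n · c n ≤ 1/(n
  -- + 1).
  set δ : ℕ → ℝ := fun n => 1 / (((n : ℝ) + 1) * (c n + 1)) with hδ
  have δpos : ∀ n, 0 < δ n := fun n => by have := c0 n; positivity
  choose F hF hlF using fun n => exists_rank_le_norm_sub_lt T (2 * n) (δpos n)
  set τ : ℕ → ℕ → ℝ := fun n i => sNumbers T (n + i) with hτ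
  have τ0 : ∀ n i, 0 ≤ τ n i := fun n i => sNumbers_nonneg T _
  have hbound : ∀ n, φ.opExt (T - F n) ≤
      2 * (2 * φ.ext (τ n)) + ENNReal.ofReal (1 / ((n : ℝ) + 1)) := by
    intro n
    set χ : ℕ → ℝ := fun i => if i < 4 * n then 1 else 0 with hχ
    have χ0 : ∀ i, 0 ≤ χ i := fun i => by simp only [hχ]; split_ifs <;> norm_num
    have hpt : ∀ i, sNumbers (T - F n) i ≤ τ n (i / 2 / 2) + δ n * χ i := by
      intro i
      -- Below 4n the bound is by the operator norm, and n + i/4 ≤ 2n. From 4n on, removing rank 2n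
      -- shifts indices by 2n, and n + i/4 ≤ i - 2n.
      by_cases hi : i < 4 * n
      · have h1 : sNumbers (T - F n) i ≤ ‖T - F n‖ := by
          rw [← sNumbers_zero_right]
          exact sNumbers_antitone _ (Nat.zero_le i)
        have h2 : sNumbers T (2 * n) ≤ τ n (i / 2 / 2) := sNumbers_antitone T (by omega)
        have h3 : χ i = 1 := by simp [hχ, hi]
        rw [h3, mul_one]
        linarith [hlF n]
      · have h1 : sNumbers (T - F n) (i - 2 * n + 2 * n) ≤
            sNumbers (T - F n - -F n) (i - 2 * n) :=
          sNumbers_add_rank_le _ (by simpa using rank_mul_le_right (-1) (hF n))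
        rw [sub_neg_eq_add, sub_add_cancel, Nat.sub_add_cancel (by omega)] at h1
        have h2 : sNumbers T (i - 2 * n) ≤ τ n (i / 2 / 2) := sNumbers_antitone T (by omega)
        have := mul_nonneg (δpos n).le (χ0 i)
        linarith
    have hχn : φ.ext χ ≤ ENNReal.ofReal (c n) := by
      refine (φ.ext_le_of_forall_ge_eq_zero (n := 4 * n) fun i hi => ?_).trans
        (ENNReal.ofReal_le_ofReal (φ.toFun_truncSeq_mono fun i hi => ?_))
      · simp [hχ, Nat.not_lt.2 hi]
      · simp [hχ, hi]
    calc φ.opExt (T - F n) ≤ φ.ext ((fun i => τ n (i / 2 / 2)) + δ n • χ) := by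
          refine φ.ext_mono fun i => ?_
          rw [abs_of_nonneg (sNumbers_nonneg _ i)]
          exact (hpt i).trans (le_abs_self _)
      _ ≤ φ.ext (fun i => τ n (i / 2 / 2)) + ENNReal.ofReal |δ n| * φ.ext χ :=
          (φ.ext_add_le _ _).trans (by gcongr; exact φ.ext_smul_le _ _)
      _ ≤ 2 * (2 * φ.ext (τ n)) + ENNReal.ofReal |δ n| * ENNReal.ofReal (c n) := by
          gcongr
          exact (φ.ext_dilate_le (fun i => τ n (i / 2))).trans
            (by gcongr; exact φ.ext_dilate_le (τ n))
      _ ≤ _ := by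
          gcongr
          rw [abs_of_pos (δpos n), ← ENNReal.ofReal_mul (δpos n).le]
          refine ENNReal.ofReal_le_ofReal ?_
          have h0 := c0 n
          rw [hδ, div_mul_eq_mul_div, one_mul, div_le_div_iff₀ (by positivity) (by positivity)]
          nlinarith [(n.cast_nonneg : (0 : ℝ) ≤ n)]
  refine ⟨F, fun n => ⟨2 * n, hF n⟩, tendsto_zero_of_le ?_ hbound⟩
  have t1 : Tendsto (fun n => 2 * (2 * φ.ext (τ n))) atTop (𝓝 0) := by
    have := ENNReal.Tendsto.const_mul (a := 2)
      (ENNReal.Tendsto.const_mul (a := 2) hT.2 (Or.inr (by simp))) (Or.inr (by simp))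
    simpa using this
  have t2 : Tendsto (fun n : ℕ => ENNReal.ofReal (1 / ((n : ℝ) + 1))) atTop (𝓝 0) := by
    have := (ENNReal.continuous_ofReal.tendsto 0).comp
      (tendsto_one_div_add_atTop_nhds_zero_nat (𝕜 := ℝ))
    simpa using! this
  simpa using t1.add t2

lemma mul_isCompactOperator {X Y : H →L[ℂ] H} (hX : φ.opExt X < ⊤) (hY : IsCompactOperator Y) :
    φ.IsApproximable (X * Y) := by
  choose G hG hle using fun n : ℕ =>
    hY.exists_hasFiniteRank_norm_sub_le (ε := 1 / ((n : ℝ) + 1)) (by positivity)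
  refine ⟨fun n => X * G n, fun n => (hG n).mul_left X, tendsto_zero_of_le
    (v := fun n : ℕ => ENNReal.ofReal (1 / ((n : ℝ) + 1)) * φ.opExt X) ?_ fun n => ?_⟩
  · have := ENNReal.Tendsto.mul_const (b := φ.opExt X)
      ((ENNReal.continuous_ofReal.tendsto 0).comp
        (tendsto_one_div_add_atTop_nhds_zero_nat (𝕜 := ℝ))) (Or.inr hX.ne)
    simpa using! this
  · rw [← mul_sub]
    refine (φ.opExt_mul_le_right _ _).trans ?_
    gcongr
    exact hle n

/-- The approximable operators are complete for rapidly converging series. -/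
lemma of_hasSum {B : ℕ → H →L[ℂ] H} {S : H →L[ℂ] H} (hB : ∀ j, φ.IsApproximable (B j))
    (hle : ∀ j, φ.opExt (B j) ≤ ENNReal.ofReal ((1 / 4) ^ j)) (hS : HasSum B S) :
    φ.IsApproximable S := by
  -- The remainder is a norm limit of finite sums with a common quasi-norm bound, which the limit
  -- inherits.
  have hrest : ∀ n, φ.opExt (S - ∑ j ∈ Finset.range n, B j) ≤
      ENNReal.ofReal (4 * (1 / 4) ^ n) := by
    intro n
    refine φ.opExt_le_of_tendsto ((hasSum_nat_add_iff' n).2 hS).tendsto_sum_nat fun m => ?_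
    refine φ.opExt_sum_range_le m _ _ (by positivity) fun j => (hle _).trans_eq ?_
    rw [pow_add, mul_comm]
  have happ : ∀ n : ℕ, ∃ F : H →L[ℂ] H, HasFiniteRank F ∧
      φ.opExt (∑ j ∈ Finset.range n, B j - F) ≤ ENNReal.ofReal ((1 / 4) ^ n) := by
    intro n
    obtain ⟨F, hF, hF'⟩ := IsApproximable.sum (s := Finset.range n) fun j _ => hB j
    obtain ⟨k, hk⟩ := (hF'.eventually_le_const
      (ENNReal.ofReal_pos.2 (by positivity : (0 : ℝ) < (1 / 4) ^ n))).exists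
    exact ⟨F k, hF k, hk⟩
  choose F hF hF' using happ
  have tq : Tendsto (fun n : ℕ => ((1 : ℝ) / 4) ^ n) atTop (𝓝 0) :=
    tendsto_pow_atTop_nhds_zero_of_lt_one (by norm_num) (by norm_num)
  refine ⟨F, hF, tendsto_zero_of_le (tendsto_two_mul_add
    (u := fun n => ENNReal.ofReal (4 * (1 / 4) ^ n))
    (v := fun n => ENNReal.ofReal ((1 / 4) ^ n)) ?_ ?_) fun n => ?_⟩
  · simpa using ENNReal.tendsto_ofReal (tq.const_mul 4)
  · simpa using ENNReal.tendsto_ofReal tq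
  · rw [← sub_add_sub_cancel S (∑ j ∈ Finset.range n, B j) (F n)]
    refine (φ.opExt_add_le _ _).trans ?_
    gcongr
    · exact hrest n
    · exact hF' n

end IsApproximable

end SymmetricNormingFunction

end IdealNorm

/-! ### Factoring out a compact operator -/

section Factorization

open Filter Topology

variable {H : Type*} [NormedAddCommGroup H] [InnerProductSpace ℂ H]

lemma Submodule.starProjection_mul_starProjection_of_le {K L : Submodule ℂ H}
    [K.HasOrthogonalProjection] [L.HasOrthogonalProjection] (h : K ≤ L) :
    L.starProjection * K.starProjection = K.starProjection := by
  ext x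
  exact Submodule.starProjection_eq_self_iff.2 (h (K.starProjection_apply_mem x))

variable [CompleteSpace H]

/-- A finite-rank operator is supported on a finite-dimensional subspace. -/
lemma HasFiniteRank.exists_mul_starProjection_eq {F : H →L[ℂ] H} (hF : HasFiniteRank F) :
    ∃ K : Submodule ℂ H, FiniteDimensional ℂ K ∧
      ∀ (L : Submodule ℂ H) [L.HasOrthogonalProjection], K ≤ L → F * L.starProjection = F := by
  have := hF.finiteDimensional_range
  -- The subspace is the range of F*F over all of H: if y is orthogonal to L, then ‖Fy‖² = ⟨y, F*Fy⟩
  -- = 0.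
  refine ⟨(LinearMap.range (F : H →ₗ[ℂ] H)).map
    (ContinuousLinearMap.adjoint F : H →ₗ[ℂ] H), inferInstance, fun L _ hKL => ?_⟩
  ext x
  have h1 : inner ℂ (x - L.starProjection x)
      (ContinuousLinearMap.adjoint F (F (x - L.starProjection x))) = 0 :=
    L.starProjection_inner_eq_zero x _
      (hKL ⟨_, LinearMap.mem_range_self (F : H →ₗ[ℂ] H) _, rfl⟩)
  rw [ContinuousLinearMap.adjoint_inner_right, inner_self_eq_zero, map_sub, sub_eq_zero] at h1
  exact h1.symm

lemma exists_monotone_mul_starProjection_eq {F : ℕ → H →L[ℂ] H} (hF : ∀ n, HasFiniteRank (F n)) :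
    ∃ Q : ℕ → H →L[ℂ] H, (∀ n, HasFiniteRank (Q n)) ∧ (∀ n, ‖Q n‖ ≤ 1) ∧
      (∀ n, ‖1 - Q n‖ ≤ 1) ∧ (∀ m n, m ≤ n → Q n * Q m = Q m) ∧
      (∀ m n, m ≤ n → Q m * Q n = Q m) ∧ ∀ n, F n * Q n = F n := by
  choose K hK hKL using fun n => (hF n).exists_mul_starProjection_eq
  let L : ℕ → Submodule ℂ H := fun n => (Finset.range (n + 1)).sup K
  have hL : ∀ n, FiniteDimensional ℂ (L n) := fun n =>
    Submodule.finiteDimensional_finset_sup _ _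
  have hmono : ∀ m n, m ≤ n → L m ≤ L n := fun m n h =>
    Finset.sup_mono (Finset.range_mono (by omega))
  refine ⟨fun n => (L n).starProjection, fun n => HasFiniteRank.starProjection _,
    fun n => (L n).starProjection_norm_le, fun n => ?_, fun m n h => ?_, fun m n h => ?_,
    fun n => ?_⟩
  · have := (L n)ᗮ.starProjection_norm_le
    rwa [Submodule.starProjection_orthogonal'] at this
  · exact Submodule.starProjection_mul_starProjection_of_le (hmono m n h)
  · exact Submodule.starProjection_comp_starProjection_of_le (hmono m n h)
  · exact hKL n (L n) (Finset.le_sup (f := K) (Finset.mem_range.2 n.lt_succ_self))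

/-- Every approximable operator is the product of an approximable and a compact operator. -/
lemma SymmetricNormingFunction.IsApproximable.exists_eq_mul {φ : SymmetricNormingFunction}
    {T : H →L[ℂ] H} (hT : φ.IsApproximable T) :
    ∃ X Y : H →L[ℂ] H, φ.IsApproximable X ∧ IsCompactOperator Y ∧ T = X * Y := by
  -- The rate 1/8 leaves 1/4 after amplification by 2ⁿ, as the series criterion requires.
  have happ : ∀ n : ℕ, ∃ F : H →L[ℂ] H, HasFiniteRank F ∧
      φ.opExt (T - F) ≤ ENNReal.ofReal ((1 / 8) ^ n) := by
    intro n
    obtain ⟨F, hF, hF'⟩ := hT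
    obtain ⟨k, hk⟩ := (hF'.eventually_le_const
      (ENNReal.ofReal_pos.2 (by positivity : (0 : ℝ) < (1 / 8) ^ n))).exists
    exact ⟨F k, hF k, hk⟩
  choose F hF hF' using happ
  obtain ⟨Q, hQ, hQ1, hQ1', hQl, hQr, hFQ⟩ := exists_monotone_mul_starProjection_eq hF
  set A : ℕ → H →L[ℂ] H := fun n => T * (1 - Q n) with hA
  have hAle : ∀ n, φ.opExt (A n) ≤ ENNReal.ofReal ((1 / 8) ^ n) := by
    intro n
    have h1 : A n = (T - F n) * (1 - Q n) := by
      rw [hA, sub_mul, mul_sub (F n), hFQ, mul_one, sub_self, sub_zero]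
    rw [h1]
    refine (φ.opExt_mul_le_right _ _).trans ((mul_le_mul' ?_ (hF' n)).trans_eq (one_mul _))
    exact ENNReal.ofReal_le_one.2 (hQ1' n)
  have hAnorm : ∀ n, ‖A n‖ ≤ (1 / 8) ^ n / φ.unit := fun n =>
    φ.norm_le_of_opExt_le (by positivity) (hAle n)
  set B : ℕ → H →L[ℂ] H := fun n => ((2 : ℂ) ^ n) • A n with hB
  have hBle : ∀ n, φ.opExt (B n) ≤ ENNReal.ofReal ((1 / 4) ^ n) := by
    intro n
    refine (φ.opExt_smul_le _ _).trans ((mul_le_mul_right (hAle n) _).trans_eq ?_)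
    rw [norm_pow, Complex.norm_ofNat, ← ENNReal.ofReal_mul (by positivity), ← mul_pow]
    norm_num
  have hBnorm : ∀ n, ‖B n‖ ≤ (1 / 4) ^ n / φ.unit := fun n =>
    φ.norm_le_of_opExt_le (by positivity) (hBle n)
  have hgeo : ∀ r : ℝ, 0 ≤ r → r < 1 → Summable fun n : ℕ => r ^ n / φ.unit := fun r h0 h1 =>
    (summable_geometric_of_lt_one h0 h1).div_const _
  have hBsum : Summable B :=
    Summable.of_norm_bounded (hgeo (1 / 4) (by norm_num) (by norm_num)) hBnorm
  -- On the block Q m - Q (m - 1) only the terms k ≥ m act, with total weight 2⁻ᵐ; there T + ∑ B n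
  -- acts as T times 1 + (1 + 2 + ⋯ + 2ᵐ⁻¹) = 2ᵐ.
  set q : ℕ → H →L[ℂ] H := fun k => ((1 / 2 : ℂ) ^ (k + 1)) • Q k with hq
  have hqsum : Summable q := by
    refine Summable.of_norm_bounded (g := fun k : ℕ => (1 / 2 : ℝ) ^ k)
      (summable_geometric_of_lt_one (by norm_num) (by norm_num)) fun k => ?_
    rw [hq, norm_smul, norm_pow]
    have : ‖(1 / 2 : ℂ)‖ = 1 / 2 := by norm_num
    rw [this, pow_succ]
    have := hQ1 k
    have h0 : (0 : ℝ) < (1 / 2) ^ k := by positivity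
    nlinarith [norm_nonneg (Q k)]
  set Y := ∑' k, q k with hY
  have hYsum : HasSum q Y := hqsum.hasSum
  have hYc : IsCompactOperator Y := by
    refine isCompactOperator_of_tendsto (l := atTop) (F := fun n => ∑ k ∈ Finset.range n, q k)
      hYsum.tendsto_sum_nat (Eventually.of_forall fun n => ?_)
    refine HasFiniteRank.isCompactOperator ?_
    refine Finset.sum_induction _ _ (fun _ _ => HasFiniteRank.add) HasFiniteRank.zero
      fun k _ => ?_
    simpa [hq] using (hQ k).mul_left ((1 / 2 : ℂ) ^ (k + 1) • 1)
  -- `Y` acts as the scalar `2⁻ᵐ` on the `m`-th block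
  have hblock : ∀ (D : H →L[ℂ] H) (m : ℕ), (∀ k < m, D * Q k = 0) → (∀ k, m ≤ k → D * Q k = D) →
      D * Y = ((1 / 2 : ℂ) ^ m) • D := by
    intro D m h0 h1
    have s1 := (hasSum_nat_add_iff' m).2 (hYsum.mul_left D)
    have z : ∑ i ∈ Finset.range m, D * q i = 0 :=
      Finset.sum_eq_zero fun i hi => by
        rw [hq, mul_smul_comm, h0 i (Finset.mem_range.1 hi), smul_zero]
    rw [z, sub_zero] at s1
    have s2 : HasSum (fun k : ℕ => ((1 / 2 : ℂ) ^ k)) 2 := by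
      have := hasSum_geometric_of_norm_lt_one (ξ := (1 / 2 : ℂ)) (by norm_num)
      norm_num at this ⊢
      exact this
    have s3 := (s2.mul_left ((1 / 2 : ℂ) ^ (m + 1))).smul_const D
    refine (s1.unique ?_).trans (b := ((1 / 2 : ℂ) ^ (m + 1) * 2) • D) ?_
    · have e : (fun k => D * q (k + m)) =
          fun k => ((1 / 2 : ℂ) ^ (m + 1) * (1 / 2 : ℂ) ^ k) • D := by
        funext k
        rw [hq, mul_smul_comm, h1 _ (Nat.le_add_left m k)]
        congr 1
        ring
      rw [e]
      exact s3
    · congr 1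
      ring
  -- Telescoping over blocks: A n - A (n + 1) is T on block n + 1. Both error terms vanish in the
  -- limit, since the last one is B n * Y.
  have hpart : ∀ n, (T + ∑ j ∈ Finset.range n, B j) * Y =
      T - A n + ((2 : ℂ) ^ n) • (A n * Y) := by
    intro n
    induction n with
    | zero =>
      have h := hblock (T * Q 0) 0 (by simp) fun k _ => by rw [mul_assoc, hQr 0 k (Nat.zero_le k)]
      rw [pow_zero, one_smul] at h
      rw [Finset.sum_range_zero, add_zero, pow_zero, one_smul, hA]
      simp only [mul_sub, sub_mul, mul_one, h]
      abel
    | succ n ih =>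
      have h := hblock (A n - A (n + 1)) (n + 1)
        (fun k hk => by
          simp only [hA, mul_sub, sub_mul, mul_one, mul_assoc]
          rw [hQl k n (by omega), hQl k (n + 1) (by omega)]
          simp)
        (fun k hk => by
          simp only [hA, mul_sub, sub_mul, mul_one, mul_assoc]
          rw [hQr n k (by omega), hQr (n + 1) k (by omega)]
          abel)
      have h' : ((2 : ℂ) ^ (n + 1)) • (A n * Y) - ((2 : ℂ) ^ (n + 1)) • (A (n + 1) * Y) =
          A n - A (n + 1) := by
        rw [← smul_sub, ← sub_mul, h, smul_smul, ← mul_pow]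
        norm_num
      rw [Finset.sum_range_succ, ← add_assoc, add_mul, ih, hB, smul_mul_assoc]
      have h2 : ((2 : ℂ) ^ (n + 1)) • (A n * Y) =
          ((2 : ℂ) ^ n) • (A n * Y) + ((2 : ℂ) ^ n) • (A n * Y) := by
        rw [← add_smul]; congr 1; ring
      rw [add_assoc, ← h2, sub_eq_iff_eq_add.1 h']
      abel
  have hBapp : ∀ n, φ.IsApproximable (B n) := fun n => (hT.mul_right _).smul _
  refine ⟨T + ∑' n, B n, Y,
    hT.add (SymmetricNormingFunction.IsApproximable.of_hasSum hBapp hBle hBsum.hasSum), hYc, ?_⟩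
  have lim1 := (hBsum.hasSum.tendsto_sum_nat.const_add T).mul_const Y
  have limA : Tendsto A atTop (𝓝 0) :=
    squeeze_zero_norm hAnorm (hgeo (1 / 8) (by norm_num) (by norm_num)).tendsto_atTop_zero
  have limB : Tendsto (fun n => B n * Y) atTop (𝓝 (0 * Y)) :=
    hBsum.tendsto_atTop_zero.mul_const Y
  have lim2 : Tendsto (fun n => (T + ∑ j ∈ Finset.range n, B j) * Y) atTop (𝓝 T) := by
    have := (limA.const_sub T).add limB
    rw [sub_zero, zero_mul, add_zero] at this
    refine this.congr fun n => ?_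
    rw [hpart, hB, smul_mul_assoc]
  exact tendsto_nhds_unique lim2 lim1

end Factorization

/-! ### The two Banach ideals and their soft pair -/

section BanachIdeals

variable {H : Type*} [NormedAddCommGroup H] [InnerProductSpace ℂ H]

lemma softInterior_mono {I J : TwoSidedIdeal (H →L[ℂ] H)} (h : I ≤ J) :
    softInterior I ≤ softInterior J := by
  refine TwoSidedIdeal.span_mono ?_
  rintro _ ⟨X, hX, Y, hY, rfl⟩
  exact ⟨X, h hX, Y, hY, rfl⟩

variable {φ : SymmetricNormingFunction}

/-- The compact operators of finite quasi-norm already form an ideal, so generating an ideal adds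
nothing. -/
lemma mem_maximalIdeal {T : H →L[ℂ] H} :
    T ∈ maximalIdeal H φ ↔ IsCompactOperator T ∧ φ.opExt T < ⊤ := by
  let J : TwoSidedIdeal (H →L[ℂ] H) :=
    TwoSidedIdeal.mk' {T | IsCompactOperator T ∧ φ.opExt T < ⊤}
    ⟨isCompactOperator_zero, φ.opExt_lt_top_of_hasFiniteRank .zero⟩
    (fun {x y} hx hy => ⟨hx.1.add hy.1, (φ.opExt_add_le x y).trans_lt
      (ENNReal.mul_lt_top (by simp) (ENNReal.add_lt_top.2 ⟨hx.2, hy.2⟩))⟩)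
    (fun {x} hx => ⟨hx.1.neg, (φ.opExt_neg x).trans_lt hx.2⟩)
    (fun {x y} hy => ⟨hy.1.clm_comp x, (φ.opExt_mul_le_left x y).trans_lt
      (ENNReal.mul_lt_top ENNReal.ofReal_lt_top hy.2)⟩)
    (fun {x y} hx => ⟨hx.1.comp_clm y, (φ.opExt_mul_le_right x y).trans_lt
      (ENNReal.mul_lt_top ENNReal.ofReal_lt_top hx.2)⟩)
  have hJ : ∀ S, S ∈ J ↔ IsCompactOperator S ∧ φ.opExt S < ⊤ := fun S => by
    rw [TwoSidedIdeal.mem_mk']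
    rfl
  constructor
  · intro h
    have : maximalIdeal H φ ≤ J := TwoSidedIdeal.span_le.2 fun S hS =>
      (hJ S).2 ⟨hS.1, hS.2.2⟩
    exact (hJ T).1 (this h)
  · exact fun h => TwoSidedIdeal.subset_span ⟨h.1, h.1.sNumbers_mem_cZeroStar, h.2⟩

variable [CompleteSpace H]

lemma mem_minimalIdeal {T : H →L[ℂ] H} : T ∈ minimalIdeal H φ ↔ φ.IsApproximable T := by
  let J : TwoSidedIdeal (H →L[ℂ] H) := TwoSidedIdeal.mk' {T | φ.IsApproximable T}
    (.of_hasFiniteRank .zero) (fun hx hy => hx.add hy)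
    (fun {x} hx => by simpa using! hx.smul (-1))
    (fun {x y} hy => hy.mul_left x) (fun {x y} hx => hx.mul_right y)
  have hJ : ∀ S, S ∈ J ↔ φ.IsApproximable S := fun S => by
    rw [TwoSidedIdeal.mem_mk']
    rfl
  constructor
  · intro h
    have : minimalIdeal H φ ≤ J := TwoSidedIdeal.span_le.2 fun S hS =>
      (hJ S).2 (.of_sNumbers_mem_minSet hS.2)
    exact (hJ T).1 (this h)
  · exact fun h => TwoSidedIdeal.subset_span ⟨h.isCompactOperator, h.sNumbers_mem_minSet⟩

/-- Infinite dimension supplies an orthonormal sequence, hence a diagonal operator for each ξ. -/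
lemma charSet_minimalIdeal (hH : ¬ FiniteDimensional ℂ H) :
    charSet (minimalIdeal H φ) = φ.minSet := by
  obtain ⟨e, he⟩ := exists_orthonormal_nat hH
  refine Set.Subset.antisymm ?_ fun ξ hξ => ?_
  · rintro _ ⟨-, T, hT, rfl⟩
    exact (mem_minimalIdeal.1 hT).sNumbers_mem_minSet
  · obtain ⟨T, -, rfl⟩ := he.exists_sNumbers_eq hξ.1.1
    exact ⟨hξ.1.1, T, mem_minimalIdeal.2 (.of_sNumbers_mem_minSet hξ), rfl⟩

lemma charSet_maximalIdeal (hH : ¬ FiniteDimensional ℂ H) :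
    charSet (maximalIdeal H φ) = φ.maxSet := by
  obtain ⟨e, he⟩ := exists_orthonormal_nat hH
  refine Set.Subset.antisymm ?_ fun ξ hξ => ?_
  · rintro _ ⟨h, T, hT, rfl⟩
    exact ⟨h, (mem_maximalIdeal.1 hT).2⟩
  · obtain ⟨T, hT, rfl⟩ := he.exists_sNumbers_eq hξ.1
    exact ⟨hξ.1, T, mem_maximalIdeal.2 ⟨hT, hξ.2⟩, rfl⟩

lemma minimalIdeal_le_maximalIdeal : minimalIdeal H φ ≤ maximalIdeal H φ := fun _ hT =>
  have hT := mem_minimalIdeal.1 hT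
  mem_maximalIdeal.2 ⟨hT.isCompactOperator, hT.opExt_lt_top⟩

lemma minimalIdeal_le_softInterior : minimalIdeal H φ ≤ softInterior (minimalIdeal H φ) := by
  intro T hT
  obtain ⟨X, Y, hX, hY, rfl⟩ := (mem_minimalIdeal.1 hT).exists_eq_mul
  exact TwoSidedIdeal.subset_span
    ⟨X, mem_minimalIdeal.2 hX, Y, mem_compactIdeal.2 hY, rfl⟩

lemma softInterior_maximalIdeal_le : softInterior (maximalIdeal H φ) ≤ minimalIdeal H φ := by
  refine TwoSidedIdeal.span_le.2 ?_
  rintro _ ⟨X, hX, Y, hY, rfl⟩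
  exact mem_minimalIdeal.2 (.mul_isCompactOperator (mem_maximalIdeal.1 hX).2
    (mem_compactIdeal.1 hY))

lemma softCover_minimalIdeal (hH : ¬ FiniteDimensional ℂ H) :
    softCover (minimalIdeal H φ) = maximalIdeal H φ := by
  rw [softCover, maximalIdeal, charSet_minimalIdeal hH]
  congr 1
  ext ξ
  refine ⟨fun h => ⟨h.1, ?_⟩, fun h => ⟨h.1, fun α hα => φ.mul_mem_minSet hα h⟩⟩
  by_contra htop
  obtain ⟨α, hα, hαtop⟩ := φ.exists_ext_mul_eq_top (not_lt_top_iff.1 htop)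
  exact (h.2 α hα).1.2.ne hαtop

lemma isStronglySoftComplemented_maximalIdeal (hH : ¬ FiniteDimensional ℂ H) :
    IsStronglySoftComplemented (maximalIdeal H φ) := by
  intro η hη
  rw [charSet_maximalIdeal hH] at hη ⊢
  obtain ⟨n, hn⟩ := φ.exists_segments_ext_eq_top (fun k => (hη k).1) fun k =>
    not_lt_top_iff.1 fun h => (hη k).2 ⟨(hη k).1, h⟩
  exact ⟨n, fun ξ _ hle hξ => hξ.2.ne (hn ξ hle)⟩

end BanachIdeals

theorem proposition4p7 {H : Type*} [NormedAddCommGroup H] [InnerProductSpace ℂ H]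
    [CompleteSpace H] [TopologicalSpace.SeparableSpace H] (hH : ¬ FiniteDimensional ℂ H)
    (φ : SymmetricNormingFunction) :
    IsSoftEdged (minimalIdeal H φ) ∧
      IsStronglySoftComplemented (maximalIdeal H φ) ∧
      IsSoftPair (minimalIdeal H φ) (maximalIdeal H φ) := by
  -- The chain min ≤ se min ≤ se max ≤ min collapses to equalities.
  have hmono := softInterior_mono (minimalIdeal_le_maximalIdeal (H := H) (φ := φ))
  exact ⟨le_antisymm (hmono.trans softInterior_maximalIdeal_le) minimalIdeal_le_softInterior,
    isStronglySoftComplemented_maximalIdeal hH, minimalIdeal_le_maximalIdeal,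
    le_antisymm softInterior_maximalIdeal_le (minimalIdeal_le_softInterior.trans hmono),
    softCover_minimalIdeal hH⟩
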